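/- Let $a,b>0$, $q\in(0,1)$, and let $\Gamma=\{a,-b\}^{\mathbb Z}$ carry the product measure $\mu$ under which each coordinate is $a$ with probability $q$ and $-b$ with probability $1-q$. Identify $\eta\in\Gamma$ with the function $\eta(t)=\eta_n$ for $t\in[n,n+1)$, $n\in\mathbb Z$, and put $(T_h\eta)(t)=\eta(t+h)$ for $h\in\mathbb R$. In $H=\ell^2$ consider $$u_1'+\eta(t)u_1=1,\qquad u_k'+k^4u_k=u_1u_k-u_k^3\quad(k=2,3,\dots),$$ where a solution on $[\tau,\infty)$ is a continuous $H$-valued function whose components satisfy the equations in integrated form, and let $U_\eta(t,\tau)$, $t\ge\tau$, be the solution process: $U_\eta(t,\tau)B$ is the set of values at time $t$ of the solutions starting at time $\tau$ in $B$. A random tempered set is a set-valued function $B$ on the hull $\{T_t\eta:\eta\in\Gamma,\ t\in\mathbb R\}$, with values in the subsets of $H$, such that for each $t\in\mathbb R$ the map $\eta\mapsto B(T_t\eta)$ on $\Gamma$ is $\mu$-measurable (for every open $O\subset H$, the set $\{\eta\in\Gamma: B(T_t\eta)\cap O\ne\varnothing\}$ is measurable for the completion of $\mu$), and, for $\mu$-almost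 every $\eta\in\Gamma$, all the sets $B(T_t\eta)$, $t\in\mathbb R$, are bounded and $e^{\theta t}\sup_{x\in B(T_t\eta)}\|x\|_H\to0$ as $t\to-\infty$ for every $\theta>0$. A random attractor is a random tempered set $\mathcal A$ such that, for $\mu$-almost every $\eta\in\Gamma$, $\mathcal A(\eta)$ is compact and $U_\eta(t,0)\mathcal A(\eta)=\mathcal A(T_t\eta)$ for all $t\ge0$, and such that for every random tempered set $B$ and $\mu$-almost every $\eta\in\Gamma$, $$\sup_{x\in U_\eta(0,\tau)B(T_\tau\eta)}\ \inf_{y\in\mathcal A(\eta)}\|x-y\|_H\to0\quad\text{as }\tau\to-\infty .$$ Suppose that $$\ln\bigl(qe^{-a}+(1-q)e^{b}\bigr)>0>-aq+(1-q)b .$$ Then the system has a random attractor, and every random attractor $\mathcal A$ of the system has infinite Hausdorff and infinite fractal dimension: $$\dim_H(\mathcal A(\eta),H)=\dim_f(\mathcal A(\eta),H)=\infty\quad\text{for }\mu\text{-almost every }\eta\in\Gamma,$$ where $\dim_f(K,H)=\limsup_{\varepsilon\to0^+}\ln N_\varepsilon(K)/\ln(1/\varepsilon)$ and $N_\varepsilon(K)$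 is the least number of balls of radius $\varepsilon$ in $H$ that cover $K$. -/

import Mathlib

open MeasureTheory Filter Topology Set
open scoped ENNReal NNReal

noncomputable section

namespace ToySystem

/-- The phase space `H = l²` of square summable real sequences `(u₁, u₂, …)`. -/
abbrev H : Type := lp (fun _ : ℕ+ => ℝ) 2

/-- The two-sided Bernoulli scheme `Γ = {a, -b}^ℤ`. -/
abbrev BernoulliScheme (a b : ℝ) : Type := ℤ → ({a, -b} : Set ℝ)

/-- The product measure on `Γ` under which every coordinate equals `a` with probability `q`
and `-b` with probability `1 - q`. -/
def bernoulliProd (a b : ℝ) (q : unitInterval) : Measure (BernoulliScheme a b) :=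
  Measure.infinitePi fun _ : ℤ =>
    ProbabilityTheory.bernoulliMeasure
      (⟨a, by simp⟩ : ({a, -b} : Set ℝ)) (⟨-b, by simp⟩ : ({a, -b} : Set ℝ)) q

/-- The damping rate attached to `η ∈ Γ`: the function equal to `η n` on `[n, n + 1)`. -/
def damping {a b : ℝ} (η : BernoulliScheme a b) : ℝ → ℝ := fun t => (η ⌊t⌋ : ℝ)

/-- Time shifts of functions on the line, `(T_h f)(t) = f (t + h)`. -/
def shift (h : ℝ) (f : ℝ → ℝ) : ℝ → ℝ := fun t => f (t + h)

/-- `u` is a solution, on the time interval `[τ, ∞)`, of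
`u₁' + f(t) u₁ = 1`, `u_k' + k⁴ u_k = u₁ u_k - u_k³` for `k ≥ 2`.
It is continuous with values in `l²`. As `f` is only piecewise continuous, the
equations are written in integrated form. -/
structure IsSolution (f : ℝ → ℝ) (τ : ℝ) (u : ℝ → H) : Prop where
  continuousOn : ContinuousOn u (Ici τ)
  eq_one : ∀ t, τ ≤ t → u t 1 = u τ 1 + ∫ s in τ..t, (1 - f s * u s 1)
  eq_of_two_le : ∀ k : ℕ+, 2 ≤ k → ∀ t, τ ≤ t →
    u t k = u τ k + ∫ s in τ..t, (u s 1 * u s k - (u s k) ^ 3 - ((k : ℕ) : ℝ) ^ 4 * u s k)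

/-- The image `U_f(t, τ) B` of the set `B` under the solution process from time `τ` to time
`t ≥ τ`. -/
def evolve (f : ℝ → ℝ) (t τ : ℝ) (B : Set H) : Set H :=
  {x | ∃ u : ℝ → H, IsSolution f τ u ∧ u τ ∈ B ∧ u t = x}

/-- A function is tempered if it grows slower than any exponential as `t → -∞`. -/
def IsTempered (φ : ℝ → ℝ) : Prop :=
  ∀ θ : ℝ, 0 < θ → Tendsto (fun t => Real.exp (θ * t) * |φ t|) atBot (𝓝 0)

/-- A tempered family of bounded sets, `‖B(t)‖` being the supremum of the norms. -/
def IsTemperedFamily (B : ℝ → Set H) : Prop :=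
  (∀ t, Bornology.IsBounded (B t)) ∧ IsTempered fun t => sSup (norm '' B t)

/-- The non-symmetric Hausdorff distance `sup_{u ∈ U} inf_{v ∈ V} ‖u - v‖`. -/
def semiDist (U V : Set H) : ℝ≥0∞ := ⨆ u ∈ U, Metric.infEDist u V

/-- A random tempered set. It is a set-valued function of the damping rate; only its values on
the hull, which consists of the shifts `T_t η` of the Bernoulli damping rates, play a role.
Measurability is that of set-valued maps, with respect to the completed measure. -/
structure IsTemperedRandomSet (a b : ℝ) (q : unitInterval) (B : (ℝ → ℝ) → Set H) : Prop where
  measurable : ∀ (t : ℝ) (O : Set H), IsOpen O →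
    NullMeasurableSet {η : BernoulliScheme a b | (B (shift t (damping η)) ∩ O).Nonempty}
      (bernoulliProd a b q)
  tempered : ∀ᵐ η ∂(bernoulliProd a b q), IsTemperedFamily fun t => B (shift t (damping η))

/-- A random attractor: a compact, strictly invariant random tempered set which attracts every
random tempered set in the pullback sense. -/
structure IsRandomAttractor (a b : ℝ) (q : unitInterval) (A : (ℝ → ℝ) → Set H) : Prop where
  isTemperedRandomSet : IsTemperedRandomSet a b q A
  isCompact : ∀ᵐ η ∂(bernoulliProd a b q), IsCompact (A (damping η))
  invariant : ∀ᵐ η ∂(bernoulliProd a b q), ∀ t : ℝ, 0 ≤ t →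
    evolve (damping η) t 0 (A (damping η)) = A (shift t (damping η))
  attracts : ∀ B : (ℝ → ℝ) → Set H, IsTemperedRandomSet a b q B →
    ∀ᵐ η ∂(bernoulliProd a b q),
      Tendsto (fun τ : ℝ =>
        semiDist (evolve (damping η) 0 τ (B (shift τ (damping η)))) (A (damping η)))
        atBot (𝓝 0)

/-- The fractal (upper box-counting) dimension `limsup_{ε → 0+} log N_ε(A) / log (1 / ε)`, where
`N_ε(A)` is the least number of balls of radius `ε` that cover `A`. -/
def fractalDim (A : Set H) : EReal :=
  limsup (fun ε : ℝ≥0 =>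
    ENNReal.log (Metric.externalCoveringNumber ε A : ℝ≥0∞) / ((Real.log (1 / ε) : ℝ) : EReal))
    (𝓝[>] 0)

end ToySystem

end

/-! The system is triangular. When the damping has positive mean in the past, the linear equation
for u₁ has the pullback equilibrium v(t) = ∫_{-∞}^t exp(-∫_s^t η) ds (`equil`), which attracts
tempered data exponentially. Along v the k-th component solves the Bernoulli equation p' = g p - p³
with g = v - k⁴, and J = 1/(2p²) turns it into the linear equation J' = 1 - 2gJ. If the past mean of
v exceeds k⁴, the pullback integral for J (`barrier`) converges, and r_k = (2J)^{-1/2} (`radius`) is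
the largest complete trajectory; the points of complete trajectories below it fill [-r_k, r_k]
(`exists_bounded_trajectory`).

The past mean of v is infinite. Up to a constant factor, v at the end of a block of m time units is
at least exp(-S), where S is the sum of the damping values in the block, and this exponential has
expectation ρ^m with ρ = qe^{-a} + (1-q)e^b > 1. The strong law over disjoint blocks bounds the past
average of v below by a constant times ρ^m/m, for every m (`growth_of_blocks`). So almost surely
every mode is unstable, and the attractor is the box {v(0)} × ∏[-r_k, r_k] with all r_k > 0. It is
compact because r_k = O(k⁻²), and it attracts because each solution lies below a perturbed barrier
that converges to the true one (`tendsto_semiDist`).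

The box contains cubes of every finite dimension, so both dimensions are infinite. Every other
random attractor must attract this box, which is a tempered random set and is carried onto itself by
the dynamics; being closed, that attractor contains the box (`attr_subset`). -/

namespace ToySystem

/-! ### Coordinates, boxes and projections in ℓ² -/

theorem hasSum_sq (x : H) : HasSum (fun k => (x k) ^ 2) (‖x‖ ^ 2) := by
  have h := lp.hasSum_norm (p := 2) (by norm_num) x
  simpa using h

theorem summable_sq (x : H) : Summable fun k => (x k) ^ 2 := (hasSum_sq x).summable

theorem abs_apply_le_norm (x : H) (k : ℕ+) : |x k| ≤ ‖x‖ :=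
  lp.norm_apply_le_norm (by norm_num) x k

/-- The element of `H` with given square summable coordinates. -/
noncomputable def ofSummable (x : ℕ+ → ℝ) (hx : Summable fun k => (x k) ^ 2) : H :=
  ⟨x, memℓp_gen (by simpa using hx)⟩

@[simp] theorem ofSummable_apply (x : ℕ+ → ℝ) (hx : Summable fun k => (x k) ^ 2) (k : ℕ+) :
    ofSummable x hx k = x k := rfl

/-- Coordinatewise convergence together with a square summable majorant of the differences
implies convergence in `H`. -/
theorem tendsto_of_coord {ι : Type*} {l : Filter ι} {u : ι → H} {x : H} {d : ℕ+ → ℝ}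
    (hd : Summable fun k => (d k) ^ 2) (hb : ∀ᶠ i in l, ∀ k, |u i k - x k| ≤ d k)
    (hc : ∀ k, Tendsto (fun i => u i k) l (𝓝 (x k))) : Tendsto u l (𝓝 x) := by
  have h1 : Tendsto (fun i => ∑' k, (u i k - x k) ^ 2) l (𝓝 (∑' _ : ℕ+, (0 : ℝ))) := by
    refine tendsto_tsum_of_dominated_convergence hd (fun k => ?_) ?_
    · have := ((hc k).sub_const (x k)).pow 2
      simpa using this
    · filter_upwards [hb] with i hi k
      rw [Real.norm_eq_abs, abs_pow]
      exact pow_le_pow_left₀ (abs_nonneg _) (hi k) 2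
  rw [tsum_zero] at h1
  have h2 : Tendsto (fun i => ‖u i - x‖ ^ 2) l (𝓝 0) := by
    refine h1.congr fun i => ?_
    exact (hasSum_sq (u i - x)).tsum_eq
  rw [tendsto_iff_norm_sub_tendsto_zero]
  have h3 := h2.sqrt
  simpa [Real.sqrt_sq] using h3

theorem continuousOn_of_coord {X : Type*} [TopologicalSpace X] {u : X → H} {S : Set X}
    {d : ℕ+ → ℝ} (hd : Summable fun k => (d k) ^ 2) (hb : ∀ x ∈ S, ∀ k, |u x k| ≤ d k)
    (hc : ∀ k, ContinuousOn (fun x => u x k) S) : ContinuousOn u S := by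
  intro x hx
  refine tendsto_of_coord (d := fun k => 2 * d k) ?_ ?_ fun k => hc k x hx
  · simpa only [mul_pow] using hd.mul_left (2 ^ 2)
  · filter_upwards [self_mem_nhdsWithin] with y hy k
    have := abs_sub (u y k) (u x k)
    linarith [hb y hy k, hb x hx k]

/-- The box in `H` with first coordinate `c` and half-widths `r k` in the coordinates `k ≥ 2`. -/
def box (c : ℝ) (r : ℕ+ → ℝ) : Set H := {x | x 1 = c ∧ ∀ k, 2 ≤ k → |x k| ≤ r k}

/-- Coordinates of the metric projection onto a box. -/
noncomputable def clamp (c : ℝ) (r : ℕ+ → ℝ) (y : ℕ+ → ℝ) (k : ℕ+) : ℝ :=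
  if k = 1 then c else max (-r k) (min (r k) (y k))

theorem ne_one_iff_two_le (k : ℕ+) : k ≠ 1 ↔ 2 ≤ k := by
  constructor
  · intro h
    have : (k : ℕ) ≠ 1 := fun h' => h (PNat.coe_eq_one_iff.mp h')
    have h2 := k.pos
    exact PNat.coe_le_coe _ _ |>.mp (show 2 ≤ (k : ℕ) by omega)
  · rintro h rfl
    exact absurd (PNat.coe_le_coe _ _ |>.mpr h) (by norm_num)

theorem abs_clamp_le {c : ℝ} {r : ℕ+ → ℝ} {y : ℕ+ → ℝ} {k : ℕ+} (hk : 2 ≤ k) (hr : 0 ≤ r k) :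
    |clamp c r y k| ≤ r k := by
  rw [clamp, if_neg ((ne_one_iff_two_le k).mpr hk), abs_le]
  exact ⟨le_max_left _ _, max_le (by linarith) (min_le_left _ _)⟩

theorem abs_clamp_le_abs {c : ℝ} {r : ℕ+ → ℝ} {y : ℕ+ → ℝ} {k : ℕ+} (hk : 2 ≤ k) (hr : 0 ≤ r k) :
    |clamp c r y k| ≤ |y k| := by
  rw [clamp, if_neg ((ne_one_iff_two_le k).mpr hk), abs_le]
  refine ⟨?_, max_le (by linarith [abs_nonneg (y k)]) ((min_le_right _ _).trans (le_abs_self _))⟩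
  rcases le_total (r k) (y k) with h | h
  · rw [min_eq_left h]
    exact le_max_of_le_right (by linarith [abs_nonneg (y k)])
  · rw [min_eq_right h]
    exact le_max_of_le_right (neg_abs_le _)

theorem clamp_of_mem {c : ℝ} {r : ℕ+ → ℝ} {x : H} (hx : x ∈ box c r) : clamp c r x = x := by
  funext k
  by_cases hk : k = 1
  · rw [clamp, if_pos hk, hk, hx.1]
  · rw [clamp, if_neg hk]
    have := abs_le.mp (hx.2 k ((ne_one_iff_two_le k).mp hk))
    rw [min_eq_right this.2, max_eq_right this.1]

theorem abs_clamp_sub_clamp_le {c : ℝ} {r : ℕ+ → ℝ} {x y : ℕ+ → ℝ} (k : ℕ+) :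
    |clamp c r x k - clamp c r y k| ≤ |x k - y k| := by
  by_cases hk : k = 1
  · simp [clamp, hk]
  · simp only [clamp, if_neg hk]
    refine (abs_max_sub_max_le_max _ _ _ _).trans ?_
    rw [sub_self, abs_zero]
    refine max_le (abs_nonneg _) ((abs_min_sub_min_le_max _ _ _ _).trans ?_)
    rw [sub_self, abs_zero]
    exact max_le (abs_nonneg _) le_rfl

/-- A coordinate known to lie in [-R, R] overshoots the smaller interval by at most the difference
of the radii. This measures the distance to the attractor in `tendsto_semiDist`. -/
theorem abs_sub_clamp_le {c : ℝ} {r : ℕ+ → ℝ} {y : ℕ+ → ℝ} {k : ℕ+} (hk : 2 ≤ k) {R : ℝ}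
    (hy : |y k| ≤ R) (hR : r k ≤ R) (hr : 0 ≤ r k) : |y k - clamp c r y k| ≤ R - r k := by
  rw [clamp, if_neg ((ne_one_iff_two_le k).mpr hk)]
  have hy := abs_le.mp hy
  rw [abs_le]
  rcases le_total (r k) (y k) with h | h
  · rw [min_eq_left h, max_eq_right (by linarith)]; constructor <;> linarith
  · rw [min_eq_right h]
    rcases le_total (-r k) (y k) with h' | h'
    · rw [max_eq_right h']; constructor <;> linarith
    · rw [max_eq_left h']; constructor <;> linarith

theorem summable_clamp {c : ℝ} {r : ℕ+ → ℝ} (hr : ∀ k, 2 ≤ k → 0 ≤ r k) (y : H) :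
    Summable fun k => (clamp c r y k) ^ 2 := by
  have h1 : Summable fun k : ℕ+ => (y k) ^ 2 + if k = 1 then c ^ 2 else 0 :=
    (summable_sq y).add (summable_of_ne_finset_zero (s := {1}) (by
      intro k hk; rw [if_neg (by simpa using hk)]))
  refine Summable.of_nonneg_of_le (fun k => sq_nonneg _) (fun k => ?_) h1
  by_cases hk : k = 1
  · rw [if_pos hk, clamp, if_pos hk]; linarith [sq_nonneg (y k)]
  · rw [if_neg hk, add_zero]
    have hk' := (ne_one_iff_two_le k).mp hk
    exact sq_le_sq.mpr (abs_clamp_le_abs hk' (hr k hk'))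

/-- The metric projection of `H` onto a box. -/
noncomputable def proj (c : ℝ) (r : ℕ+ → ℝ) (hr : ∀ k, 2 ≤ k → 0 ≤ r k) (y : H) : H :=
  ofSummable (clamp c r y) (summable_clamp hr y)

theorem proj_mem {c : ℝ} {r : ℕ+ → ℝ} (hr : ∀ k, 2 ≤ k → 0 ≤ r k) (y : H) :
    proj c r hr y ∈ box c r :=
  ⟨by simp [proj, clamp], fun k hk => abs_clamp_le hk (hr k hk)⟩

theorem proj_of_mem {c : ℝ} {r : ℕ+ → ℝ} (hr : ∀ k, 2 ≤ k → 0 ≤ r k) {x : H} (hx : x ∈ box c r) :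
    proj c r hr x = x := lp.ext (clamp_of_mem hx)

theorem norm_le_of_abs_le {x y : H} (h : ∀ k, |x k| ≤ |y k|) : ‖x‖ ≤ ‖y‖ := by
  have := hasSum_le (fun k => sq_le_sq.mpr (h k)) (hasSum_sq x) (hasSum_sq y)
  exact (abs_le_of_sq_le_sq' this (norm_nonneg _)).2

theorem lipschitzWith_proj {c : ℝ} {r : ℕ+ → ℝ} (hr : ∀ k, 2 ≤ k → 0 ≤ r k) :
    LipschitzWith 1 (proj c r hr) := by
  refine LipschitzWith.of_dist_le_mul fun x y => ?_
  rw [NNReal.coe_one, one_mul, dist_eq_norm, dist_eq_norm]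
  exact norm_le_of_abs_le fun k => abs_clamp_sub_clamp_le k

/-- By Tychonoff the product of the intervals is compact for the product topology. A square summable
majorant makes the inclusion of this product into ℓ² continuous, so the box is a continuous image of
a compact set. -/
theorem isCompact_box {c : ℝ} {r : ℕ+ → ℝ} (hs : Summable fun k => (r k) ^ 2) : IsCompact (box c r) := by
  let d : ℕ+ → ℝ := fun k => if k = 1 then |c| else r k
  have hd : Summable fun k => (d k) ^ 2 := by
    have h1 : Summable fun k : ℕ+ => (r k) ^ 2 + if k = 1 then c ^ 2 else 0 :=
      hs.add (summable_of_ne_finset_zero (s := {1}) (by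
        intro k hk; rw [if_neg (by simpa using hk)]))
    refine Summable.of_nonneg_of_le (fun k => sq_nonneg _) (fun k => ?_) h1
    by_cases hk : k = 1
    · simp only [d, if_pos hk, sq_abs]; linarith [sq_nonneg (r k)]
    · simp only [d, if_neg hk, add_zero, le_refl]
  -- The factor at `k = 1` is the degenerate interval [c, c].
  let S : Set (ℕ+ → ℝ) := pi univ fun k => Icc (if k = 1 then c else -r k) (if k = 1 then c else r k)
  have hS : IsCompact S := isCompact_univ_pi fun k => isCompact_Icc
  have hSd : ∀ x ∈ S, ∀ k, |x k| ≤ d k := by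
    intro x hx k
    have h := hx k (mem_univ k)
    by_cases hk : k = 1
    · simp only [if_pos hk] at h
      simp only [d, if_pos hk]
      rw [le_antisymm h.2 h.1]
    · simp only [if_neg hk] at h
      simp only [d, if_neg hk]
      exact abs_le.mpr h
  have hsum : ∀ x ∈ S, Summable fun k => (x k) ^ 2 := fun x hx =>
    Summable.of_nonneg_of_le (fun k => sq_nonneg _)
      (fun k => sq_le_sq.mpr ((hSd x hx k).trans (le_abs_self _))) hd
  classical
  let F : (ℕ+ → ℝ) → H := fun x => if hx : x ∈ S then ofSummable x (hsum x hx) else 0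
  have hF : ∀ x ∈ S, ∀ k, F x k = x k := fun x hx k => by simp only [F, dif_pos hx, ofSummable_apply]
  have hcont : ContinuousOn F S := by
    refine continuousOn_of_coord hd (fun x hx k => ?_) fun k => ?_
    · rw [hF x hx]; exact hSd x hx k
    · exact (continuous_apply k).continuousOn.congr fun x hx => hF x hx k
  have : box c r = F '' S := by
    ext x
    constructor
    · intro hx
      have hxS : (x : ℕ+ → ℝ) ∈ S := by
        intro k _
        by_cases hk : k = 1
        · simp only [hk, if_true, hx.1, Icc_self, mem_singleton_iff]
        · simp only [if_neg hk]
          exact abs_le.mp (hx.2 k ((ne_one_iff_two_le k).mp hk))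
      exact ⟨x, hxS, lp.ext (funext fun k => hF _ hxS k)⟩
    · rintro ⟨y, hy, rfl⟩
      refine ⟨?_, fun k hk => ?_⟩
      · rw [hF y hy]
        have h := hy 1 (mem_univ _)
        simpa using h
      · rw [hF y hy]
        have := hSd y hy k
        simpa only [d, if_neg ((ne_one_iff_two_le k).mpr hk)] using this
  rw [this]
  exact hS.image_of_continuousOn hcont

/-! ### Infinite dimension of sets containing a nondegenerate box -/

/-- The coordinates `2, …, n + 1` of a point of `H`. -/
def coords (n : ℕ) (x : H) : Fin n → ℝ := fun i => x ⟨i + 2, by omega⟩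

theorem lipschitzWith_coords (n : ℕ) : LipschitzWith 1 (coords n) := by
  refine LipschitzWith.of_dist_le_mul fun x y => ?_
  rw [NNReal.coe_one, one_mul, dist_pi_le_iff dist_nonneg]
  intro i
  rw [dist_eq_norm, dist_eq_norm]
  exact lp.norm_apply_le_norm (by norm_num) (x - y) _

theorem exists_closedBall_subset_coords_image {c : ℝ} {r : ℕ+ → ℝ} (hr : ∀ k, 2 ≤ k → 0 < r k)
    {S : Set H} (hS : box c r ⊆ S) (n : ℕ) :
    ∃ δ : ℝ, 0 < δ ∧ Metric.closedBall (0 : Fin n → ℝ) δ ⊆ coords n '' S := by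
  have hex : ∃ δ : ℝ, 0 < δ ∧ ∀ i : Fin n, δ ≤ r ⟨i + 2, by omega⟩ := by
    rcases isEmpty_or_nonempty (Fin n) with hn | hn
    · exact ⟨1, one_pos, fun i => hn.elim i⟩
    · obtain ⟨i, hi⟩ := Finite.exists_min fun i : Fin n => r ⟨i + 2, by omega⟩
      exact ⟨_, hr _ ((PNat.coe_le_coe _ _).mp (by simp)), hi⟩
  obtain ⟨δ, hδ, hle⟩ := hex
  refine ⟨δ, hδ, fun y hy => ?_⟩
  -- The preimage of `y` has `c` in coordinate 1, `y` in coordinates 2, …, n + 1, and zeros beyond.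
  let x : ℕ+ → ℝ := fun k => if k = 1 then c else if h : (k : ℕ) - 2 < n then y ⟨k - 2, h⟩ else 0
  have hx : Summable fun k => (x k) ^ 2 := by
    refine summable_of_ne_finset_zero (s := Finset.Icc 1 ⟨n + 2, by omega⟩) fun k hk => ?_
    have h1 : (n : ℕ) + 2 < k := by
      by_contra hcon
      exact hk (Finset.mem_Icc.mpr ⟨one_le, PNat.coe_le_coe _ _ |>.mp (not_lt.mp hcon)⟩)
    have h2 : k ≠ 1 := by rintro rfl; simp at h1
    simp only [x, if_neg h2, dif_neg (show ¬ (k : ℕ) - 2 < n by omega)]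
    norm_num
  have key : ∀ (i : Fin n) (k : ℕ+), (k : ℕ) = i + 2 → x k = y i := fun i k hk => by
    have h2 : k ≠ 1 := by
      rintro rfl
      rw [PNat.one_coe] at hk
      omega
    have h3 : (k : ℕ) - 2 = i := by omega
    simp only [x, if_neg h2, h3, i.isLt, dif_pos]
  refine ⟨ofSummable x hx, hS ⟨by simp [x], fun k hk => ?_⟩, funext fun i => key i ⟨i + 2, by omega⟩ rfl⟩
  have hk1 := (ne_one_iff_two_le k).mpr hk
  have hk2 : 2 ≤ (k : ℕ) := PNat.coe_le_coe _ _ |>.mpr hk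
  simp only [ofSummable_apply, x, if_neg hk1]
  split_ifs with h
  · have hb : |y ⟨k - 2, h⟩| ≤ δ := by
      have := (dist_pi_le_iff hδ.le).mp (Metric.mem_closedBall.mp hy) ⟨k - 2, h⟩
      simpa [Real.dist_eq] using this
    refine hb.trans ((hle ⟨k - 2, h⟩).trans_eq ?_)
    congr 1
    exact PNat.coe_inj.mp (show (k : ℕ) - 2 + 2 = k by omega)
  · rw [abs_zero]; exact (hr k hk).le

/-- For each `n` the 1-Lipschitz map `coords n` sends the set onto one with nonempty interior in ℝⁿ.
Lipschitz maps do not raise Hausdorff dimension, so it is at least every `n`. -/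
theorem dimH_eq_top_of_box_subset {c : ℝ} {r : ℕ+ → ℝ} (hr : ∀ k, 2 ≤ k → 0 < r k)
    {S : Set H} (hS : box c r ⊆ S) : dimH S = ⊤ := by
  refine ENNReal.eq_top_of_forall_nnreal_le fun p => ?_
  obtain ⟨n, hn⟩ := exists_nat_ge p
  obtain ⟨δ, hδ, hsub⟩ := exists_closedBall_subset_coords_image hr hS n
  have h1 : dimH (coords n '' S) = n := by
    have := Real.dimH_of_nonempty_interior (E := Fin n → ℝ) (s := coords n '' S)
      ⟨0, interior_mono hsub (by
        rw [mem_interior_iff_mem_nhds]; exact Metric.closedBall_mem_nhds _ hδ)⟩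
    simpa using this
  calc (p : ℝ≥0∞) ≤ n := by exact_mod_cast hn
    _ = dimH (coords n '' S) := h1.symm
    _ ≤ dimH S := (lipschitzWith_coords n).dimH_image_le S

/-- Volume comparison: a cover by ε-balls projects to a cover of a cube of side 2δ in ℝⁿ by cubes of
side 2ε. -/
theorem le_externalCoveringNumber {c : ℝ} {r : ℕ+ → ℝ} (hr : ∀ k, 2 ≤ k → 0 < r k)
    {S : Set H} (hS : box c r ⊆ S) (n : ℕ) : ∃ δ : ℝ, 0 < δ ∧ ∀ ε : ℝ≥0, 0 < ε →
      ENNReal.ofReal ((δ / ε) ^ n) ≤ (Metric.externalCoveringNumber ε S : ℝ≥0∞) := by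
  obtain ⟨δ, hδ, hsub⟩ := exists_closedBall_subset_coords_image hr hS n
  refine ⟨δ, hδ, fun ε hε => ?_⟩
  rcases eq_or_ne (Metric.externalCoveringNumber ε S) ⊤ with htop | htop
  · simp [htop]
  have hmin : ∃ C : Set H, Metric.IsCover ε S C ∧ C.encard = Metric.externalCoveringNumber ε S := by
    have := Nonempty.intro (⟨S, Metric.IsCover.refl ε S⟩ : {C : Set H // Metric.IsCover ε S C})
    obtain ⟨C, hC⟩ := ENat.exists_eq_iInf fun C : {C : Set H // Metric.IsCover ε S C} => C.1.encard
    exact ⟨C.1, C.2, by rw [hC, Metric.externalCoveringNumber, iInf_subtype']⟩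
  obtain ⟨C, hC, hcard⟩ := hmin
  have hfin : C.Finite := Set.encard_ne_top_iff.mp (hcard ▸ htop)
  have hcov : coords n '' S ⊆ ⋃ y ∈ hfin.toFinset, Metric.closedBall (coords n y) ε := by
    rintro _ ⟨x, hx, rfl⟩
    have := Metric.isCover_iff_subset_iUnion_closedBall.mp hC hx
    simp only [mem_iUnion] at this ⊢
    obtain ⟨y, hy, hxy⟩ := this
    refine ⟨y, hfin.mem_toFinset.mpr hy, ?_⟩
    have h := (lipschitzWith_coords n).dist_le_mul x y
    rw [NNReal.coe_one, one_mul] at h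
    exact Metric.mem_closedBall.mpr (h.trans (Metric.mem_closedBall.mp hxy))
  have hvol : ENNReal.ofReal ((2 * δ) ^ n) ≤ hfin.toFinset.card * ENNReal.ofReal ((2 * ε) ^ n) := by
    calc ENNReal.ofReal ((2 * δ) ^ n) = volume (Metric.closedBall (0 : Fin n → ℝ) δ) := by
          rw [Real.volume_pi_closedBall _ hδ.le, Fintype.card_fin]
      _ ≤ volume (⋃ y ∈ hfin.toFinset, Metric.closedBall (coords n y) (ε : ℝ)) :=
          measure_mono (hsub.trans hcov)
      _ ≤ ∑ y ∈ hfin.toFinset, volume (Metric.closedBall (coords n y) (ε : ℝ)) :=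
          measure_biUnion_finset_le _ _
      _ = _ := by
          simp_rw [Real.volume_pi_closedBall _ ε.coe_nonneg, Fintype.card_fin]
          rw [Finset.sum_const, nsmul_eq_mul]
  have hε' : (0 : ℝ) < ε := hε
  rw [← hcard, hfin.encard_eq_coe_toFinset_card]
  rw [← ENNReal.ofReal_natCast, ← ENNReal.ofReal_mul (by positivity)] at hvol
  have h3 := (ENNReal.ofReal_le_ofReal_iff (by positivity)).mp hvol
  have h4 : (δ / ε) ^ n ≤ hfin.toFinset.card := by
    rw [div_pow, div_le_iff₀ (by positivity)]
    rw [mul_pow, mul_pow] at h3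
    have : (0 : ℝ) < 2 ^ n := by positivity
    nlinarith
  calc ENNReal.ofReal ((δ / ε) ^ n) ≤ ENNReal.ofReal hfin.toFinset.card := ENNReal.ofReal_le_ofReal h4
    _ = _ := by simp

theorem fractalDim_eq_top_of_box_subset {c : ℝ} {r : ℕ+ → ℝ} (hr : ∀ k, 2 ≤ k → 0 < r k)
    {S : Set H} (hS : box c r ⊆ S) : fractalDim S = ⊤ := by
  refine EReal.eq_top_iff_forall_lt _ |>.mpr fun y => ?_
  obtain ⟨n, hn⟩ := exists_nat_gt y
  refine lt_of_lt_of_le (show ((y : ℝ) : EReal) < ((n : ℝ) : EReal) by exact_mod_cast hn) ?_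
  -- One dimension more than needed: the spare factor 1/ε absorbs the constant δ^(n+1) once ε ≤
  -- δ^(n+1).
  obtain ⟨δ, hδ, hcov⟩ := le_externalCoveringNumber hr hS (n + 1)
  refine le_limsup_of_frequently_le (Eventually.frequently ?_) (by isBoundedDefault)
  let e : ℝ≥0 := min (1 / 2) (δ.toNNReal ^ (n + 1))
  have he : 0 < e := lt_min (by norm_num) (by positivity)
  filter_upwards [Ioo_mem_nhdsGT he] with ε hε
  have hε0 : (0 : ℝ) < ε := hε.1
  have hε1 : (ε : ℝ) < 1 / 2 := by
    have := hε.2.trans_le (min_le_left _ _)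
    exact_mod_cast this
  have hε2 : (ε : ℝ) ≤ δ ^ (n + 1) := by
    have := (hε.2.trans_le (min_le_right _ _)).le
    have h := NNReal.coe_le_coe.mpr this
    simpa [Real.coe_toNNReal _ hδ.le] using h
  have hlog : 0 < Real.log (1 / ε) := Real.log_pos (by rw [lt_div_iff₀ hε0]; linarith)
  rw [EReal.le_div_iff_mul_le (by exact_mod_cast hlog) (EReal.coe_ne_top _)]
  have h1 : (1 / (ε : ℝ)) ^ n ≤ (δ / ε) ^ (n + 1) := by
    rw [div_pow, div_pow, one_pow, div_le_div_iff₀ (by positivity) (by positivity), one_mul, pow_succ,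
      mul_comm]
    gcongr
  calc ((n : ℝ) : EReal) * ((Real.log (1 / ε) : ℝ) : EReal)
      = ENNReal.log (ENNReal.ofReal ((1 / (ε : ℝ)) ^ n)) := by
        rw [ENNReal.log_ofReal_of_pos (by positivity), Real.log_pow, EReal.coe_mul]
    _ ≤ _ := ENNReal.log_le_log ((ENNReal.ofReal_le_ofReal h1).trans (hcov ε hε.1))

end ToySystem

/-! ### The equilibrium, the barriers and the candidate attractor -/

namespace ToySystem

/-- The pullback limit of the first component at time `t`. -/
noncomputable def equil (f : ℝ → ℝ) (t : ℝ) : ℝ :=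
  ∫ s in Iic t, Real.exp (-∫ r in s..t, f r)

/-- `1 / (2 p²)` for the largest complete trajectory `p` of the `k`-th component. -/
noncomputable def barrier (f : ℝ → ℝ) (k : ℕ+) (t : ℝ) : ℝ :=
  ∫ s in Iic t, Real.exp (-2 * ∫ r in s..t, (equil f r - ((k : ℕ) : ℝ) ^ 4))

/-- The largest complete trajectory of the `k`-th component. -/
noncomputable def radius (f : ℝ → ℝ) (k : ℕ+) (t : ℝ) : ℝ := (√(2 * barrier f k t))⁻¹

/-- The attractor of the system driven by `f`. -/
noncomputable def attr (f : ℝ → ℝ) : Set H := box (equil f 0) fun k => radius f k 0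

theorem radius_nonneg (f : ℝ → ℝ) (k : ℕ+) (t : ℝ) : 0 ≤ radius f k t := by
  unfold radius; positivity

theorem setIntegral_Iic_comp_add (φ : ℝ → ℝ) (h t : ℝ) :
    ∫ s in Iic t, φ (s + h) = ∫ s in Iic (t + h), φ s := by
  have := (measurePreserving_add_right volume h).setIntegral_preimage_emb
    (measurableEmbedding_addRight h) φ (Iic (t + h))
  rw [← this]
  congr 2
  ext s
  simp

theorem equil_shift (f : ℝ → ℝ) (h t : ℝ) : equil (shift h f) t = equil f (t + h) := by
  unfold equil
  rw [← setIntegral_Iic_comp_add _ h t]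
  refine setIntegral_congr_fun measurableSet_Iic fun s _ => ?_
  simp only [shift]
  rw [intervalIntegral.integral_comp_add_right]

theorem barrier_shift (f : ℝ → ℝ) (k : ℕ+) (h t : ℝ) :
    barrier (shift h f) k t = barrier f k (t + h) := by
  unfold barrier
  rw [← setIntegral_Iic_comp_add _ h t]
  refine setIntegral_congr_fun measurableSet_Iic fun s _ => ?_
  simp only [equil_shift]
  rw [intervalIntegral.integral_comp_add_right fun r => equil f r - ((k : ℕ) : ℝ) ^ 4]

theorem attr_shift (f : ℝ → ℝ) (h : ℝ) :
    attr (shift h f) = box (equil f h) fun k => radius f k h := by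
  simp only [attr, radius, equil_shift, barrier_shift, zero_add]

theorem inv_sqrt_two_mul_iff {x J : ℝ} (hJ : 0 < J) :
    |x| ≤ (√(2 * J))⁻¹ ↔ 2 * x ^ 2 * J ≤ 1 := by
  have hs : 0 < √(2 * J) := by positivity
  rw [← one_div, le_div_iff₀ hs, ← sq_le_one_iff₀ (by positivity), mul_pow, sq_abs,
    Real.sq_sqrt (by positivity)]
  ring_nf

theorem inv_sqrt_two_mul_le {J k M : ℝ} (hk : 0 < k) (hM : 0 < M)
    (h : Real.exp (-2) * k ^ 4 / M ^ 2 ≤ J) : (√(2 * J))⁻¹ ≤ Real.exp 1 * M / k ^ 2 := by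
  have h1 : 0 < Real.exp (-1) * k ^ 2 / M := by positivity
  have h2 : (Real.exp (-1) * k ^ 2 / M) ^ 2 ≤ 2 * J := by
    have : (Real.exp (-1) * k ^ 2 / M) ^ 2 = Real.exp (-2) * k ^ 4 / M ^ 2 := by
      rw [div_pow, mul_pow, ← Real.exp_nat_mul]; ring_nf
    have h0 : 0 < Real.exp (-2) * k ^ 4 / M ^ 2 := by positivity
    rw [this]; linarith
  have h3 := Real.le_sqrt_of_sq_le h2
  calc (√(2 * J))⁻¹ ≤ (Real.exp (-1) * k ^ 2 / M)⁻¹ := inv_anti₀ h1 h3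
    _ = _ := by rw [Real.exp_neg]; field_simp

theorem summable_sq_div_sq (c : ℝ) : Summable fun k : ℕ+ => (c / ((k : ℕ) : ℝ) ^ 2) ^ 2 := by
  have h1 : Summable fun n : ℕ => 1 / (n : ℝ) ^ 4 := Real.summable_one_div_nat_pow.mpr (by norm_num)
  have h2 := (h1.comp_injective PNat.coe_injective).mul_left (c ^ 2)
  refine h2.congr fun k => ?_
  simp only [Function.comp]
  rw [div_pow, ← pow_mul]; ring

/-! ### Calculus of one-sided derivatives and pullback integrals -/

section Calculus

/-- Extending the integrand by constants beyond the interval makes it continuous on the line, where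
the fundamental theorem of calculus holds at every point. -/
theorem exists_primitive {φ : ℝ → ℝ} {a b : ℝ} (hab : a ≤ b) (h : ContinuousOn φ (Icc a b)) :
    ContinuousOn (fun t => ∫ s in a..t, φ s) (Icc a b) ∧
    ∀ x ∈ Ico a b, HasDerivWithinAt (fun t => ∫ s in a..t, φ s) (φ x) (Ici x) x := by
  let ψ : ℝ → ℝ := IccExtend hab ((Icc a b).domRestrict φ)
  have hψ : Continuous ψ := h.domRestrict.Icc_extend'
  have heq : ∀ x ∈ Icc a b, ψ x = φ x := fun x hx => by
    simp only [ψ, IccExtend_of_mem _ _ hx, domRestrict_apply]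
  have hint : ∀ t ∈ Icc a b, ∫ s in a..t, φ s = ∫ s in a..t, ψ s := fun t ht =>
    intervalIntegral.integral_congr fun s hs => by
      rw [uIcc_of_le ht.1] at hs
      exact (heq s ⟨hs.1, hs.2.trans ht.2⟩).symm
  have hder : ∀ x, HasDerivAt (fun t => ∫ s in a..t, ψ s) (ψ x) x := fun x =>
    hψ.integral_hasStrictDerivAt a x |>.hasDerivAt
  refine ⟨(fun x hx => ((hder x).continuousAt.continuousWithinAt).congr hint (hint x hx)), ?_⟩
  intro x hx
  rw [← heq x ⟨hx.1, hx.2.le⟩]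
  refine (hder x).hasDerivWithinAt.congr_of_eventuallyEq ?_ (hint x ⟨hx.1, hx.2.le⟩)
  filter_upwards [Icc_mem_nhdsGE hx.2] with t ht
  exact hint t ⟨hx.1.trans ht.1, ht.2⟩

/-- The quantity `1 - 2 p² J` does not change sign along solutions of `p' = g p - p³`,
`J' = 1 - 2 g J`. -/
theorem two_mul_sq_mul_le_one {p g J : ℝ → ℝ} {a b : ℝ} (hab : a ≤ b)
    (hp : ContinuousOn p (Icc a b))
    (hp' : ∀ x ∈ Ico a b, HasDerivWithinAt p (g x * p x - p x ^ 3) (Ici x) x)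
    (hJ : ContinuousOn J (Icc a b))
    (hJ' : ∀ x ∈ Ico a b, HasDerivWithinAt J (1 - 2 * g x * J x) (Ici x) x)
    (ha : 2 * p a ^ 2 * J a ≤ 1) : 2 * p b ^ 2 * J b ≤ 1 := by
  obtain ⟨hP, hP'⟩ := exists_primitive hab (hp.pow 2)
  -- With y = 1 - 2p²J the two equations give y' = -2p² y, since the terms in `g` cancel. Hence
  -- exp(2∫p²) is an integrating factor and y keeps its sign.
  set P : ℝ → ℝ := fun t => ∫ s in a..t, p s ^ 2
  have hconst := constant_of_has_deriv_right_zero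
    (f := fun t => (1 - 2 * p t ^ 2 * J t) * Real.exp (2 * P t)) (a := a) (b := b)
    ((continuousOn_const.sub ((continuousOn_const.mul (hp.pow 2)).mul hJ)).mul
      (continuousOn_const.mul hP).rexp) (fun x hx => by
      have h1 := (((hp' x hx).pow 2).const_mul 2).mul (hJ' x hx)
      have h2 := ((hP' x hx).const_mul 2).exp
      have h3 := (h1.const_sub 1).mul h2
      refine h3.congr_deriv ?_
      simp only [Pi.pow_apply, Pi.mul_apply]
      ring)
  have h := hconst b (right_mem_Icc.mpr hab)
  have hPa : P a = 0 := intervalIntegral.integral_same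
  simp only [hPa, mul_zero, Real.exp_zero, mul_one] at h
  have : 0 ≤ (1 - 2 * p b ^ 2 * J b) * Real.exp (2 * P b) := by rw [h]; linarith
  have := nonneg_of_mul_nonneg_left this (Real.exp_pos _)
  linarith

/-- Only right derivatives are claimed because the damping jumps at integers and is merely right
continuous. -/
theorem hasDerivWithinAt_of_integral_eq {p φ : ℝ → ℝ} {τ : ℝ}
    (hm : AEStronglyMeasurable φ (volume.restrict (Ici τ)))
    (hi : ∀ t, τ ≤ t → IntervalIntegrable φ volume τ t)
    (hc : ∀ x, τ ≤ x → ContinuousWithinAt φ (Ici x) x)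
    (heq : ∀ t, τ ≤ t → p t = p τ + ∫ s in τ..t, φ s) (x : ℝ) (hx : τ ≤ x) :
    HasDerivWithinAt p (φ x) (Ici x) x := by
  have hm' : StronglyMeasurableAtFilter φ (𝓝[Ioi x] x) :=
    ⟨Ioi x, self_mem_nhdsWithin, hm.mono_set fun y hy => hx.trans (le_of_lt hy)⟩
  have h1 := intervalIntegral.integral_hasDerivWithinAt_right (s := Ici x) (t := Ioi x) (hi x hx) hm'
    ((hc x hx).mono Ioi_subset_Ici_self)
  refine (h1.const_add (p τ)).congr (fun t ht => heq t (hx.trans ht)) (heq x hx)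

/-- A uniform lower bound for the solution of `J' = 1 - 2 (w - κ) J`. -/
theorem le_integral_exp {w : ℝ → ℝ} {t M κ : ℝ} (hw : ContinuousOn w (Icc (t - 1) t))
    (hM : 1 ≤ M) (hb : ∀ s ∈ Icc (t - 1) t, w s ≤ M) :
    IntervalIntegrable (fun s => Real.exp (-2 * ∫ r in s..t, (w r - κ))) volume (t - 1) t ∧
    Real.exp (-2) * κ / M ^ 2 ≤ ∫ s in (t - 1)..t, Real.exp (-2 * ∫ r in s..t, (w r - κ)) := by
  have hM0 : 0 < M := one_pos.trans_le hM
  have hle : t - 1 ≤ t := by linarith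
  have hMi : 1 / M ≤ 1 := by rw [div_le_one hM0]; exact hM
  have hMi0 : 0 < 1 / M := by positivity
  have hwκ : ContinuousOn (fun r => w r - κ) (Icc (t - 1) t) := hw.sub continuousOn_const
  have hii : ∀ s ∈ Icc (t - 1) t, ∀ s' ∈ Icc (t - 1) t,
      IntervalIntegrable (fun r => w r - κ) volume s s' := fun s hs s' hs' =>
    (hwκ.mono (uIcc_subset_Icc hs hs')).intervalIntegrable
  have hcont : ContinuousOn (fun s => Real.exp (-2 * ∫ r in s..t, (w r - κ))) (Icc (t - 1) t) := by
    have h1 := (exists_primitive hle hwκ).1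
    have h2 : ContinuousOn (fun s => Real.exp (-2 * ((∫ r in (t - 1)..t, (w r - κ)) -
        ∫ r in (t - 1)..s, (w r - κ)))) (Icc (t - 1) t) := by fun_prop
    refine h2.congr fun s hs => ?_
    have := intervalIntegral.integral_interval_sub_left (hii (t - 1) (left_mem_Icc.mpr hle) t
      (right_mem_Icc.mpr hle)) (hii (t - 1) (left_mem_Icc.mpr hle) s hs)
    simp only [this]
  have hint : IntervalIntegrable (fun s => Real.exp (-2 * ∫ r in s..t, (w r - κ))) volume
      (t - 1) t := (by rwa [uIcc_of_le hle] : ContinuousOn _ (uIcc (t - 1) t)).intervalIntegrable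
  refine ⟨hint, ?_⟩
  -- On the window of length 1/M the integral of `w` is at most 1, which costs only the factor e⁻².
  -- There e^y ≥ y is applied to y = 2κ(t - s), and integrating gives κ/M².
  have hsub : Icc (t - 1 / M) t ⊆ Icc (t - 1) t := Icc_subset_Icc_left (by linarith)
  have hle' : t - 1 / M ≤ t := by linarith
  have hint' : IntervalIntegrable (fun s => Real.exp (-2 * ∫ r in s..t, (w r - κ))) volume
      (t - 1 / M) t :=
    (by rw [uIcc_of_le hle']; exact hcont.mono hsub :
      ContinuousOn _ (uIcc (t - 1 / M) t)).intervalIntegrable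
  calc Real.exp (-2) * κ / M ^ 2
      = ∫ s in (t - 1 / M)..t, Real.exp (-2) * (2 * κ * (t - s)) := by
        rw [intervalIntegral.integral_const_mul, intervalIntegral.integral_const_mul,
          intervalIntegral.integral_comp_sub_left (fun s => s), integral_id]
        field_simp
        ring
    _ ≤ ∫ s in (t - 1 / M)..t, Real.exp (-2 * ∫ r in s..t, (w r - κ)) := by
        refine intervalIntegral.integral_mono_on hle' (Continuous.intervalIntegrable (by fun_prop) _ _)
          hint' fun s hs => ?_
        have hs' := hsub hs
        have h1 : ∫ r in s..t, (w r - κ) ≤ ∫ _ in s..t, (M - κ) := by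
          refine intervalIntegral.integral_mono_on hs.2 (hii s hs' t (right_mem_Icc.mpr hle))
            intervalIntegrable_const fun r hr => ?_
          have := hb r ⟨hs'.1.trans hr.1, hr.2⟩
          linarith
        rw [intervalIntegral.integral_const, smul_eq_mul] at h1
        have h2 : (t - s) * M ≤ 1 := by
          have : t - s ≤ 1 / M := by linarith [hs.1]
          rwa [le_div_iff₀ hM0] at this
        have h3 : -2 + 2 * κ * (t - s) ≤ -2 * ∫ r in s..t, (w r - κ) := by nlinarith
        calc Real.exp (-2) * (2 * κ * (t - s))
            ≤ Real.exp (-2) * Real.exp (2 * κ * (t - s)) := by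
              gcongr
              linarith [Real.add_one_le_exp (2 * κ * (t - s))]
          _ = Real.exp (-2 + 2 * κ * (t - s)) := (Real.exp_add _ _).symm
          _ ≤ _ := Real.exp_le_exp.mpr h3
    _ ≤ ∫ s in (t - 1)..t, Real.exp (-2 * ∫ r in s..t, (w r - κ)) := by
        refine intervalIntegral.integral_mono_interval (by linarith) hle' le_rfl ?_ hint
        exact Eventually.of_forall fun s => (Real.exp_pos _).le

theorem integrableOn_Iic_of_continuous {φ : ℝ → ℝ} (hφ : Continuous φ)
    (h : IntegrableOn φ (Iic 0)) (t : ℝ) : IntegrableOn φ (Iic t) := by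
  refine (h.union (hφ.integrableOn_Icc (a := 0) (b := t))).mono_set fun s hs => ?_
  rcases le_total s 0 with h0 | h0
  · exact Or.inl h0
  · exact Or.inr ⟨h0, hs⟩

theorem hasDerivAt_integral_Iic {φ : ℝ → ℝ} (hφ : Continuous φ)
    (h : IntegrableOn φ (Iic 0)) (t : ℝ) : HasDerivAt (fun t => ∫ s in Iic t, φ s) (φ t) t := by
  have heq : (fun t => ∫ s in Iic t, φ s) = fun t => (∫ s in Iic 0, φ s) + ∫ s in (0 : ℝ)..t, φ s := by
    funext t
    rw [← intervalIntegral.integral_Iic_sub_Iic h (integrableOn_Iic_of_continuous hφ h t)]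
    ring
  rw [heq]
  exact (hφ.integral_hasStrictDerivAt 0 t).hasDerivAt.const_add _

theorem integral_Iic_pos {φ : ℝ → ℝ} (hφ : Continuous φ)
    (h : IntegrableOn φ (Iic 0)) (hpos : ∀ s, 0 < φ s) (t : ℝ) : 0 < ∫ s in Iic t, φ s := by
  rw [setIntegral_pos_iff_support_of_nonneg_ae (Eventually.of_forall fun s => (hpos s).le)
    (integrableOn_Iic_of_continuous hφ h t)]
  have : Function.support φ = univ := by ext s; simp [(hpos s).ne']
  rw [this, univ_inter, Real.volume_Iic]
  exact ENNReal.zero_lt_top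

theorem integrableOn_exp_Iic_of_le {G : ℝ → ℝ} (hG : Continuous G) {c C : ℝ} (hc : 0 < c)
    (h : ∀ᶠ s in atBot, G s ≤ c * s + C) : IntegrableOn (fun s => Real.exp (G s)) (Iic 0) := by
  obtain ⟨s₀, hs₀⟩ := eventually_atBot.mp h
  have h1 : IntegrableOn (fun s => Real.exp (G s)) (Iic s₀) := by
    refine Integrable.mono' ((integrableOn_exp_mul_Iic hc s₀).mul_const (Real.exp C))
      (hG.rexp.aestronglyMeasurable) ?_
    refine (ae_restrict_iff' measurableSet_Iic).mpr (Eventually.of_forall fun s hs => ?_)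
    rw [Real.norm_eq_abs, abs_of_pos (Real.exp_pos _), ← Real.exp_add]
    exact Real.exp_le_exp.mpr (hs₀ s hs)
  refine (h1.union (hG.rexp.integrableOn_Icc (a := s₀) (b := 0))).mono_set fun s hs => ?_
  rcases le_total s s₀ with h0 | h0
  · exact Or.inl h0
  · exact Or.inr ⟨h0, hs⟩

end Calculus

end ToySystem

/-! ### Equilibrium and barriers along a typical damping path -/

namespace ToySystem

/-- A bounded right continuous damping rate with positive mean `lam` in the past, whose
equilibrium `equil f` has infinite mean in the past. -/
structure IsGoodPath (K lam : ℝ) (f : ℝ → ℝ) : Prop where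
  measurable : Measurable f
  abs_le_bound : ∀ t, |f t| ≤ K
  rightCts : ∀ t, ContinuousWithinAt f (Ici t) t
  lam_pos : 0 < lam
  mean : Tendsto (fun s => (∫ r in s..0, f r) / (-s)) atBot (𝓝 lam)
  growth : ∀ C : ℝ, ∀ᶠ s in atBot, C * (-s) ≤ ∫ r in s..0, equil f r

/-- As `IsGoodPath`, without the condition on the mean of the equilibrium. -/
structure IsDissipativePath (K lam : ℝ) (f : ℝ → ℝ) : Prop where
  measurable : Measurable f
  abs_le_bound : ∀ t, |f t| ≤ K
  rightCts : ∀ t, ContinuousWithinAt f (Ici t) t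
  lam_pos : 0 < lam
  mean : Tendsto (fun s => (∫ r in s..0, f r) / (-s)) atBot (𝓝 lam)

variable {K lam : ℝ} {f : ℝ → ℝ}

namespace IsDissipativePath

theorem K_nonneg (hf : IsDissipativePath K lam f) : 0 ≤ K := (abs_nonneg _).trans (hf.abs_le_bound 0)

theorem intervalIntegrable (hf : IsDissipativePath K lam f) (a b : ℝ) :
    IntervalIntegrable f volume a b :=
  (intervalIntegrable_const (c := K)).mono_fun hf.measurable.aestronglyMeasurable
    (Eventually.of_forall fun t => by
      simpa only [Real.norm_eq_abs, abs_of_nonneg hf.K_nonneg] using hf.abs_le_bound t)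

theorem abs_integral_le (hf : IsDissipativePath K lam f) (a b : ℝ) :
    |∫ r in a..b, f r| ≤ K * |b - a| :=
  intervalIntegral.norm_integral_le_of_norm_le_const (f := f) fun t _ => hf.abs_le_bound t

theorem integral_eq_sub (hf : IsDissipativePath K lam f) (a b : ℝ) :
    ∫ r in a..b, f r = (∫ r in (0 : ℝ)..b, f r) - ∫ r in (0 : ℝ)..a, f r :=
  (intervalIntegral.integral_interval_sub_left (hf.intervalIntegrable 0 b)
    (hf.intervalIntegrable 0 a)).symm

theorem continuous_integral (hf : IsDissipativePath K lam f) :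
    Continuous fun t => ∫ r in (0 : ℝ)..t, f r :=
  intervalIntegral.continuous_primitive hf.intervalIntegrable 0

theorem hasDerivWithinAt_integral (hf : IsDissipativePath K lam f) (a t : ℝ) :
    HasDerivWithinAt (fun t => ∫ r in a..t, f r) (f t) (Ici t) t :=
  intervalIntegral.integral_hasDerivWithinAt_right (t := Ioi t) (hf.intervalIntegrable a t)
    ⟨univ, univ_mem, hf.measurable.aestronglyMeasurable⟩ ((hf.rightCts t).mono Ioi_subset_Ici_self)

/-- Before some `s₀` this is convergence of the mean; on [s₀, 0] both terms are bounded, and `C`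
absorbs them. -/
theorem exists_mean_bound (hf : IsDissipativePath K lam f) {ε : ℝ} (hε : 0 < ε) :
    ∃ C, ∀ s, s ≤ 0 → |(∫ r in (0 : ℝ)..s, f r) - lam * s| ≤ ε * (-s) + C := by
  have h1 := hf.mean
  rw [Metric.tendsto_nhds] at h1
  obtain ⟨s₀, hs₀⟩ := eventually_atBot.mp ((h1 ε hε).and (eventually_lt_atBot 0))
  have hK := hf.K_nonneg
  have hl := hf.lam_pos
  refine ⟨(K + lam) * |s₀|, fun s hs => ?_⟩
  rcases le_total s s₀ with h | h
  · obtain ⟨h2, h3⟩ := hs₀ s h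
    have h4 : 0 < -s := by linarith
    rw [Real.dist_eq, div_sub' h4.ne', abs_div, abs_of_pos h4, div_lt_iff₀ h4] at h2
    rw [intervalIntegral.integral_symm, show -(∫ r in s..0, f r) - lam * s =
      -((∫ r in s..0, f r) - -s * lam) by ring, abs_neg]
    have : 0 ≤ (K + lam) * |s₀| := by positivity
    linarith
  · have h2 := hf.abs_integral_le 0 s
    have h3 : |s| ≤ |s₀| := by
      rw [abs_of_nonpos hs, abs_of_nonpos (h.trans hs)]; linarith
    calc |(∫ r in (0 : ℝ)..s, f r) - lam * s| ≤ |∫ r in (0 : ℝ)..s, f r| + |lam * s| := abs_sub _ _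
      _ ≤ K * |s| + lam * |s| := by
          rw [abs_mul, abs_of_pos hl]
          rw [sub_zero] at h2
          linarith
      _ ≤ (K + lam) * |s₀| := by rw [← add_mul]; gcongr
      _ ≤ _ := by
          have : 0 ≤ ε * (-s) := by nlinarith
          linarith

theorem integrableOn_exp (hf : IsDissipativePath K lam f) :
    IntegrableOn (fun s => Real.exp (∫ r in (0 : ℝ)..s, f r)) (Iic 0) := by
  obtain ⟨C, hC⟩ := hf.exists_mean_bound (half_pos hf.lam_pos)
  refine integrableOn_exp_Iic_of_le hf.continuous_integral (c := lam / 2) (C := C)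
    (half_pos hf.lam_pos) ?_
  filter_upwards [eventually_le_atBot 0] with s hs
  have := (abs_le.mp (hC s hs)).2
  linarith

/-- Splitting the exponent at time 0 removes `t` from the integrand, so that continuity and the
differential equation follow from the product rule. -/
theorem equil_eq (hf : IsDissipativePath K lam f) (t : ℝ) : equil f t =
    Real.exp (-∫ r in (0 : ℝ)..t, f r) * ∫ s in Iic t, Real.exp (∫ r in (0 : ℝ)..s, f r) := by
  unfold equil
  rw [← integral_const_mul]
  refine integral_congr_ae (Eventually.of_forall fun s => ?_)
  simp only
  rw [hf.integral_eq_sub s t, ← Real.exp_add]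
  congr 1; ring

theorem continuous_equil (hf : IsDissipativePath K lam f) : Continuous (equil f) := by
  have h1 : Continuous fun t => ∫ s in Iic t, Real.exp (∫ r in (0 : ℝ)..s, f r) :=
    continuous_iff_continuousAt.mpr fun t =>
      (hasDerivAt_integral_Iic hf.continuous_integral.rexp hf.integrableOn_exp t).continuousAt
  rw [funext hf.equil_eq]
  exact hf.continuous_integral.neg.rexp.mul h1

theorem hasDerivWithinAt_equil (hf : IsDissipativePath K lam f) (t : ℝ) :
    HasDerivWithinAt (equil f) (1 - f t * equil f t) (Ici t) t := by
  have h1 := (hasDerivAt_integral_Iic hf.continuous_integral.rexp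
    hf.integrableOn_exp t).hasDerivWithinAt (s := Ici t)
  have h2 := ((hf.hasDerivWithinAt_integral 0 t).neg.exp).mul h1
  rw [funext hf.equil_eq]
  refine h2.congr_deriv ?_
  simp only [Pi.neg_apply]
  rw [← Real.exp_add, neg_add_cancel, Real.exp_zero]
  ring

theorem equil_pos (hf : IsDissipativePath K lam f) (t : ℝ) : 0 < equil f t := by
  rw [hf.equil_eq]
  exact mul_pos (Real.exp_pos _) (integral_Iic_pos hf.continuous_integral.rexp hf.integrableOn_exp
    (fun s => Real.exp_pos _) t)

/-- Variation of constants, with the positive contribution of the times in (s, t] dropped. It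
carries growth across a block of negative damping. -/
theorem exp_mul_equil_le (hf : IsDissipativePath K lam f) {s t : ℝ} (hst : s ≤ t) :
    Real.exp (-∫ r in s..t, f r) * equil f s ≤ equil f t := by
  rw [hf.equil_eq, hf.equil_eq, hf.integral_eq_sub s t, ← mul_assoc, ← Real.exp_add,
    show -((∫ r in (0 : ℝ)..t, f r) - ∫ r in (0 : ℝ)..s, f r) + -∫ r in (0 : ℝ)..s, f r =
      -∫ r in (0 : ℝ)..t, f r by ring]
  refine mul_le_mul_of_nonneg_left ?_ (Real.exp_pos _).le
  exact setIntegral_mono_set (integrableOn_Iic_of_continuous hf.continuous_integral.rexp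
    hf.integrableOn_exp t) (Eventually.of_forall fun s => (Real.exp_pos _).le)
    (Iic_subset_Iic.mpr hst).eventuallyLE

theorem exp_neg_le_equil (hf : IsDissipativePath K lam f) (t : ℝ) : Real.exp (-K) ≤ equil f t := by
  have hi : IntegrableOn (fun s => Real.exp (-∫ r in s..t, f r)) (Iic t) := by
    have := (integrableOn_Iic_of_continuous hf.continuous_integral.rexp
      hf.integrableOn_exp t).const_mul (Real.exp (-∫ r in (0 : ℝ)..t, f r))
    refine this.congr (Eventually.of_forall fun s => ?_)
    simp only
    rw [hf.integral_eq_sub s t, ← Real.exp_add]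
    congr 1; ring
  calc Real.exp (-K) = ∫ _ in Icc (t - 1) t, Real.exp (-K) := by simp
    _ ≤ ∫ s in Icc (t - 1) t, Real.exp (-∫ r in s..t, f r) := by
        refine setIntegral_mono_on (by simp) (hi.mono_set Icc_subset_Iic_self) measurableSet_Icc
          fun s hs => Real.exp_le_exp.mpr ?_
        have h1 := (abs_le.mp (hf.abs_integral_le s t)).2
        have h2 : |t - s| ≤ 1 := abs_le.mpr ⟨by linarith [hs.2], by linarith [hs.1]⟩
        have := mul_le_mul_of_nonneg_left h2 hf.K_nonneg
        linarith
    _ ≤ equil f t := setIntegral_mono_set hi (Eventually.of_forall fun s => (Real.exp_pos _).le)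
        Icc_subset_Iic_self.eventuallyLE

/-- The equilibrium grows subexponentially in the past: the prefactor grows at rate at most lam + δ
and the integral decays at rate at least lam - δ, so only 2δ is left. -/
theorem exists_equil_le (hf : IsDissipativePath K lam f) {ε : ℝ} (hε : 0 < ε) :
    ∃ C, 1 ≤ C ∧ ∀ t, t ≤ 0 → equil f t ≤ C * Real.exp (-(ε * t)) := by
  -- The first bound gives 2δ ≤ ε; the second keeps lam - δ positive, so that the integral
  -- converges.
  set δ := min (ε / 2) (lam / 2)
  have hlam := hf.lam_pos
  have hδ : 0 < δ := lt_min (by linarith) (by linarith)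
  have hδ1 : 2 * δ ≤ ε := by have : δ ≤ ε / 2 := min_le_left _ _; linarith
  have hδ2 : 0 < lam - δ := by have : δ ≤ lam / 2 := min_le_right _ _; linarith
  obtain ⟨C, hC⟩ := hf.exists_mean_bound hδ
  refine ⟨max 1 (Real.exp (2 * C) / (lam - δ)), le_max_left _ _, fun t ht => ?_⟩
  have h1 : ∫ s in Iic t, Real.exp (∫ r in (0 : ℝ)..s, f r) ≤
      Real.exp C * (Real.exp ((lam - δ) * t) / (lam - δ)) := by
    rw [← integral_exp_mul_Iic hδ2, ← integral_const_mul]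
    refine setIntegral_mono_on (integrableOn_Iic_of_continuous hf.continuous_integral.rexp
      hf.integrableOn_exp t) ((integrableOn_exp_mul_Iic hδ2 t).const_mul _) measurableSet_Iic
      fun s hs => ?_
    rw [← Real.exp_add]
    have := (abs_le.mp (hC s (le_trans hs ht))).2
    exact Real.exp_le_exp.mpr (by linarith)
  have h2 : -∫ r in (0 : ℝ)..t, f r ≤ C - (lam + δ) * t := by
    have := (abs_le.mp (hC t ht)).1
    linarith
  rw [hf.equil_eq]
  calc _ ≤ Real.exp (C - (lam + δ) * t) * (Real.exp C * (Real.exp ((lam - δ) * t) / (lam - δ))) := by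
        gcongr
    _ = Real.exp (2 * C) / (lam - δ) * Real.exp (-(2 * δ * t)) := by
        rw [show Real.exp (C - (lam + δ) * t) * (Real.exp C * (Real.exp ((lam - δ) * t) / (lam - δ)))
          = (Real.exp (C - (lam + δ) * t) * Real.exp C * Real.exp ((lam - δ) * t)) / (lam - δ) by ring,
          ← Real.exp_add, ← Real.exp_add, div_mul_eq_mul_div, ← Real.exp_add]
        congr 2; ring
    _ ≤ max 1 (Real.exp (2 * C) / (lam - δ)) * Real.exp (-(ε * t)) := by
        exact mul_le_mul (le_max_right _ _) (Real.exp_le_exp.mpr (by nlinarith))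
          (Real.exp_pos _).le (by positivity)

theorem intervalIntegrable_equil (hf : IsDissipativePath K lam f) (a b : ℝ) :
    IntervalIntegrable (equil f) volume a b := hf.continuous_equil.intervalIntegrable a b

end IsDissipativePath

namespace IsGoodPath

theorem toDissipative (hf : IsGoodPath K lam f) : IsDissipativePath K lam f :=
  ⟨hf.measurable, hf.abs_le_bound, hf.rightCts, hf.lam_pos, hf.mean⟩

/-- A primitive of the growth rate of the `k`-th component along the equilibrium. -/
theorem integral_eq_sub (hf : IsGoodPath K lam f) (k : ℕ+) (a b : ℝ) :
    ∫ r in a..b, (equil f r - ((k : ℕ) : ℝ) ^ 4) =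
      (∫ r in (0 : ℝ)..b, (equil f r - ((k : ℕ) : ℝ) ^ 4)) -
        ∫ r in (0 : ℝ)..a, (equil f r - ((k : ℕ) : ℝ) ^ 4) := by
  have hc : Continuous fun r => equil f r - ((k : ℕ) : ℝ) ^ 4 :=
    hf.toDissipative.continuous_equil.sub continuous_const
  exact (intervalIntegral.integral_interval_sub_left (hc.intervalIntegrable 0 b)
    (hc.intervalIntegrable 0 a)).symm

theorem hasDerivAt_rate (hf : IsGoodPath K lam f) (k : ℕ+) (t : ℝ) :
    HasDerivAt (fun t => ∫ r in (0 : ℝ)..t, (equil f r - ((k : ℕ) : ℝ) ^ 4))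
      (equil f t - ((k : ℕ) : ℝ) ^ 4) t := by
  have hc : Continuous fun r => equil f r - ((k : ℕ) : ℝ) ^ 4 :=
    hf.toDissipative.continuous_equil.sub continuous_const
  exact (hc.integral_hasStrictDerivAt 0 t).hasDerivAt

theorem continuous_rate (hf : IsGoodPath K lam f) (k : ℕ+) :
    Continuous fun t => Real.exp (2 * ∫ r in (0 : ℝ)..t, (equil f r - ((k : ℕ) : ℝ) ^ 4)) :=
  (continuous_const.mul (continuous_iff_continuousAt.mpr fun t =>
    (hf.hasDerivAt_rate k t).continuousAt)).rexp

/-- The infinite past mean of the equilibrium beats k⁴ + 1, so the integrand is eventually at most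
exp(2s). This is why no mode, however large `k`, dies out. -/
theorem integrableOn_exp (hf : IsGoodPath K lam f) (k : ℕ+) : IntegrableOn
    (fun t => Real.exp (2 * ∫ r in (0 : ℝ)..t, (equil f r - ((k : ℕ) : ℝ) ^ 4))) (Iic 0) := by
  refine integrableOn_exp_Iic_of_le (continuous_const.mul (continuous_iff_continuousAt.mpr fun t =>
    (hf.hasDerivAt_rate k t).continuousAt)) (c := 2) (C := 0) two_pos ?_
  filter_upwards [hf.growth (((k : ℕ) : ℝ) ^ 4 + 1)] with s hs
  rw [intervalIntegral.integral_sub (hf.toDissipative.intervalIntegrable_equil _ _)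
    intervalIntegrable_const, intervalIntegral.integral_const, intervalIntegral.integral_symm,
    smul_eq_mul]
  linarith

theorem barrier_eq (hf : IsGoodPath K lam f) (k : ℕ+) (t : ℝ) : barrier f k t =
    Real.exp (-2 * ∫ r in (0 : ℝ)..t, (equil f r - ((k : ℕ) : ℝ) ^ 4)) *
      ∫ s in Iic t, Real.exp (2 * ∫ r in (0 : ℝ)..s, (equil f r - ((k : ℕ) : ℝ) ^ 4)) := by
  unfold barrier
  rw [← integral_const_mul]
  refine integral_congr_ae (Eventually.of_forall fun s => ?_)
  simp only
  rw [hf.integral_eq_sub k s t, ← Real.exp_add]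
  congr 1; ring

theorem barrier_pos (hf : IsGoodPath K lam f) (k : ℕ+) (t : ℝ) : 0 < barrier f k t := by
  rw [hf.barrier_eq]
  exact mul_pos (Real.exp_pos _) (integral_Iic_pos (hf.continuous_rate k) (hf.integrableOn_exp k)
    (fun s => Real.exp_pos _) t)

theorem hasDerivAt_barrier (hf : IsGoodPath K lam f) (k : ℕ+) (t : ℝ) :
    HasDerivAt (barrier f k) (1 - 2 * (equil f t - ((k : ℕ) : ℝ) ^ 4) * barrier f k t) t := by
  have h1 := hasDerivAt_integral_Iic (hf.continuous_rate k) (hf.integrableOn_exp k) t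
  have h2 := (((hf.hasDerivAt_rate k t).const_mul (-2)).exp).mul h1
  rw [funext (hf.barrier_eq k)]
  refine h2.congr_deriv ?_
  beta_reduce
  generalize (∫ r in (0 : ℝ)..t, (equil f r - ((k : ℕ) : ℝ) ^ 4)) = A
  rw [← Real.exp_add, neg_mul, neg_add_cancel, Real.exp_zero]
  ring

theorem integrableOn_barrier (hf : IsGoodPath K lam f) (k : ℕ+) (t : ℝ) : IntegrableOn
    (fun s => Real.exp (-2 * ∫ r in s..t, (equil f r - ((k : ℕ) : ℝ) ^ 4))) (Iic t) := by
  have := (integrableOn_Iic_of_continuous (hf.continuous_rate k) (hf.integrableOn_exp k)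
      t).const_mul (Real.exp (-2 * ∫ r in (0 : ℝ)..t, (equil f r - ((k : ℕ) : ℝ) ^ 4)))
  refine this.congr (Eventually.of_forall fun s => ?_)
  simp only
  rw [hf.integral_eq_sub k s t, ← Real.exp_add]
  congr 1; ring

theorem radius_pos (hf : IsGoodPath K lam f) (k : ℕ+) (t : ℝ) : 0 < radius f k t := by
  have := hf.barrier_pos k t
  unfold radius; positivity

theorem abs_le_radius_iff (hf : IsGoodPath K lam f) (k : ℕ+) (t x : ℝ) :
    |x| ≤ radius f k t ↔ 2 * x ^ 2 * barrier f k t ≤ 1 :=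
  inv_sqrt_two_mul_iff (hf.barrier_pos k t)

/-- The last unit of time alone contributes at least a constant times k⁴/M² to the barrier. The
resulting k⁻² decay gives square summability and hence compactness. -/
theorem radius_le (hf : IsGoodPath K lam f) (k : ℕ+) {t M : ℝ} (hM : 1 ≤ M)
    (hb : ∀ s ∈ Icc (t - 1) t, equil f s ≤ M) :
    radius f k t ≤ Real.exp 1 * M / ((k : ℕ) : ℝ) ^ 2 := by
  have hk : (0 : ℝ) < (k : ℕ) := by exact_mod_cast k.pos
  refine inv_sqrt_two_mul_le hk (by linarith) ?_
  refine (le_integral_exp hf.toDissipative.continuous_equil.continuousOn hM hb).2.trans ?_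
  rw [intervalIntegral.integral_of_le (by linarith)]
  exact setIntegral_mono_set (hf.integrableOn_barrier k t)
    (Eventually.of_forall fun s => (Real.exp_pos _).le) Ioc_subset_Iic_self.eventuallyLE

theorem summable_radius (hf : IsGoodPath K lam f) (t : ℝ) :
    Summable fun k => (radius f k t) ^ 2 := by
  obtain ⟨M, hM⟩ := (isCompact_Icc (a := t - 1) (b := t)).bddAbove_image
    hf.toDissipative.continuous_equil.continuousOn
  refine Summable.of_nonneg_of_le (fun k => sq_nonneg _) (fun k => ?_)
    (summable_sq_div_sq (Real.exp 1 * max 1 M))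
  refine pow_le_pow_left₀ (radius_nonneg f k t) (hf.radius_le k (le_max_left _ _) fun s hs => ?_) 2
  exact (hM (mem_image_of_mem _ hs)).trans (le_max_right _ _)

theorem isCompact_attr_at (hf : IsGoodPath K lam f) (t : ℝ) :
    IsCompact (box (equil f t) fun k => radius f k t) := isCompact_box (hf.summable_radius t)

end IsGoodPath

end ToySystem

/-! ### Solutions, complete trajectories and invariance -/

namespace ToySystem

variable {K lam : ℝ} {f : ℝ → ℝ}

theorem continuous_apply_lp (k : ℕ+) : Continuous fun x : H => x k := by
  refine (LipschitzWith.of_dist_le_mul (K := 1) fun x y => ?_).continuous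
  rw [NNReal.coe_one, one_mul, dist_eq_norm, dist_eq_norm]
  exact lp.norm_apply_le_norm (by norm_num) (x - y) k

namespace IsSolution

variable {τ : ℝ} {u : ℝ → H}

theorem continuousOn_apply (hu : IsSolution f τ u) (k : ℕ+) :
    ContinuousOn (fun t => u t k) (Ici τ) :=
  (continuous_apply_lp k).comp_continuousOn hu.continuousOn

theorem hasDerivWithinAt_one (hu : IsSolution f τ u) (hf : IsDissipativePath K lam f) {t : ℝ}
    (ht : τ ≤ t) : HasDerivWithinAt (fun t => u t 1) (1 - f t * u t 1) (Ici t) t := by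
  have hc := hu.continuousOn_apply 1
  refine hasDerivWithinAt_of_integral_eq (p := fun t => u t 1) (φ := fun s => 1 - f s * u s 1)
    ?_ ?_ ?_ hu.eq_one t ht
  · exact aestronglyMeasurable_const.sub (hf.measurable.aestronglyMeasurable.mul
      (hc.aestronglyMeasurable measurableSet_Ici))
  · intro t ht
    refine intervalIntegrable_const.sub ((hf.intervalIntegrable τ t).mul_continuousOn ?_)
    rw [uIcc_of_le ht]
    exact hc.mono Icc_subset_Ici_self
  · intro x hx
    exact continuousWithinAt_const.sub ((hf.rightCts x).mul
      ((hc x hx).mono (Ici_subset_Ici.mpr hx)))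

theorem hasDerivWithinAt_of_two_le (hu : IsSolution f τ u) {k : ℕ+} (hk : 2 ≤ k) {t : ℝ}
    (ht : τ ≤ t) : HasDerivWithinAt (fun t => u t k)
      ((u t 1 - ((k : ℕ) : ℝ) ^ 4) * u t k - u t k ^ 3) (Ici t) t := by
  have hc1 := hu.continuousOn_apply 1
  have hck := hu.continuousOn_apply k
  have hc : ContinuousOn (fun s => u s 1 * u s k - (u s k) ^ 3 - ((k : ℕ) : ℝ) ^ 4 * u s k)
      (Ici τ) := ((hc1.mul hck).sub (hck.pow 3)).sub (continuousOn_const.mul hck)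
  have h := hasDerivWithinAt_of_integral_eq (p := fun t => u t k)
    (hc.aestronglyMeasurable measurableSet_Ici) (fun t ht =>
      (by rw [uIcc_of_le ht]; exact hc.mono Icc_subset_Ici_self :
        ContinuousOn _ (uIcc τ t)).intervalIntegrable)
    (fun x hx => (hc x hx).mono (Ici_subset_Ici.mpr hx)) (hu.eq_of_two_le k hk) t ht
  exact h.congr_deriv (by ring)

/-- The first component is attracted by the equilibrium. -/
theorem sub_equil_eq (hu : IsSolution f τ u) (hf : IsDissipativePath K lam f) {t : ℝ}
    (ht : τ ≤ t) :
    u t 1 - equil f t = Real.exp (-∫ r in τ..t, f r) * (u τ 1 - equil f τ) := by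
  have hcF : Continuous fun t => ∫ r in τ..t, f r :=
    intervalIntegral.continuous_primitive hf.intervalIntegrable τ
  have hconst := constant_of_has_deriv_right_zero
    (f := fun t => (u t 1 - equil f t) * Real.exp (∫ r in τ..t, f r)) (a := τ) (b := t)
    ((((hu.continuousOn_apply 1).mono Icc_subset_Ici_self).sub hf.continuous_equil.continuousOn).mul
      hcF.rexp.continuousOn) (fun x hx => by
      have h1 := (hu.hasDerivWithinAt_one hf hx.1).sub (hf.hasDerivWithinAt_equil x)
      have h2 := (hf.hasDerivWithinAt_integral τ x).exp
      refine (h1.mul h2).congr_deriv ?_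
      simp only [Pi.sub_apply]
      ring) t ⟨ht, le_rfl⟩
  simp only [intervalIntegral.integral_same, Real.exp_zero, mul_one] at hconst
  rw [← hconst, mul_comm, mul_assoc, ← Real.exp_add, add_neg_cancel, Real.exp_zero, mul_one]

/-- Every solution is bounded by the solution which starts at infinity. -/
theorem two_mul_sq_mul_le (hu : IsSolution f τ u) {k : ℕ+} (hk : 2 ≤ k) {t : ℝ} (ht : τ ≤ t) :
    2 * u t k ^ 2 * ∫ s in τ..t, Real.exp (-2 * ∫ r in s..t, (u r 1 - ((k : ℕ) : ℝ) ^ 4)) ≤ 1 := by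
  have hg : ContinuousOn (fun r => u r 1 - ((k : ℕ) : ℝ) ^ 4) (Icc τ t) :=
    ((hu.continuousOn_apply 1).mono Icc_subset_Ici_self).sub continuousOn_const
  obtain ⟨hG, hG'⟩ := exists_primitive ht hg
  have hE : ContinuousOn (fun s => Real.exp (2 * ∫ r in τ..s, (u r 1 - ((k : ℕ) : ℝ) ^ 4)))
      (Icc τ t) := (continuousOn_const.mul hG).rexp
  obtain ⟨hN, hN'⟩ := exists_primitive ht hE
  -- This `J` vanishes at `τ`, corresponding to an infinite initial value, so the initial inequality
  -- holds whatever `u τ k` is.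
  have h := two_mul_sq_mul_le_one (p := fun s => u s k) (g := fun r => u r 1 - ((k : ℕ) : ℝ) ^ 4)
    (J := fun x => Real.exp (-2 * ∫ r in τ..x, (u r 1 - ((k : ℕ) : ℝ) ^ 4)) *
      ∫ s in τ..x, Real.exp (2 * ∫ r in τ..s, (u r 1 - ((k : ℕ) : ℝ) ^ 4))) ht
    ((hu.continuousOn_apply k).mono Icc_subset_Ici_self)
    (fun x hx => hu.hasDerivWithinAt_of_two_le hk hx.1)
    ((continuousOn_const.mul hG).rexp.mul hN) (fun x hx => by
      refine ((((hG' x hx).const_mul (-2)).exp).mul (hN' x hx)).congr_deriv ?_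
      beta_reduce
      generalize (∫ r in τ..x, (u r 1 - ((k : ℕ) : ℝ) ^ 4)) = A
      rw [← Real.exp_add, neg_mul, neg_add_cancel, Real.exp_zero]
      ring) (by simp)
  convert h using 2
  rw [← intervalIntegral.integral_const_mul]
  refine intervalIntegral.integral_congr fun s hs => ?_
  rw [uIcc_of_le ht] at hs
  have hii : ∀ x ∈ Icc τ t, IntervalIntegrable (fun r => u r 1 - ((k : ℕ) : ℝ) ^ 4) volume τ x :=
    fun x hx => (hg.mono (uIcc_subset_Icc (left_mem_Icc.mpr ht) hx)).intervalIntegrable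
  simp only
  rw [← Real.exp_add, ← intervalIntegral.integral_interval_sub_left (hii t ⟨ht, le_rfl⟩) (hii s hs)]
  congr 1
  ring

end IsSolution

/-- Solutions of `p' = g p - p³` below the barrier `exp (-2 G) N` exist for all times. -/
theorem exists_bounded_trajectory {g G N : ℝ → ℝ} (hG : ∀ s, HasDerivAt G (g s) s)
    (hN : ∀ s, HasDerivAt N (Real.exp (2 * G s)) s) (hNpos : ∀ s, 0 < N s) {T x : ℝ}
    (hx : 2 * x ^ 2 * (Real.exp (-2 * G T) * N T) ≤ 1) : ∃ p : ℝ → ℝ, p T = x ∧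
      (∀ s, HasDerivAt p (g s * p s - p s ^ 3) s) ∧
      ∀ s, 2 * p s ^ 2 * (Real.exp (-2 * G s) * N s) ≤ 1 := by
  -- Explicit solution of the Bernoulli equation: p = x e^{G(s) - G(T)} / √D(s) with D(s) = 1 +
  -- c(N(s) - N(T)). The barrier condition at `T` says c N(T) ≤ 1, which keeps `D` positive for all
  -- past times and excludes backward blow-up.
  let c : ℝ := 2 * x ^ 2 * Real.exp (-2 * G T)
  let D : ℝ → ℝ := fun s => 1 - c * N T + c * N s
  have hc : 0 ≤ c := by positivity
  have hcT : c * N T ≤ 1 := by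
    calc c * N T = 2 * x ^ 2 * (Real.exp (-2 * G T) * N T) := by ring
      _ ≤ 1 := hx
  have hD : ∀ s, 0 < D s := fun s => by
    rcases hc.eq_or_lt with h | h
    · simp [D, ← h]
    · have := mul_pos h (hNpos s)
      simp only [D]; linarith
  have hexp : ∀ s, Real.exp (G s - G T) ^ 2 = Real.exp (-2 * G T) * Real.exp (2 * G s) := fun s => by
    rw [← Real.exp_add, ← Real.exp_nat_mul]
    congr 1
    push_cast
    ring
  refine ⟨fun s => x * Real.exp (G s - G T) / √(D s), ?_, fun s => ?_, fun s => ?_⟩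
  · simp [D]
  · have h1 : HasDerivAt D (c * Real.exp (2 * G s)) s := ((hN s).const_mul c).const_add _
    have h2 := h1.sqrt (hD s).ne'
    have h3 := ((((hG s).sub_const (G T)).exp.const_mul x).div h2 (Real.sqrt_pos.mpr (hD s)).ne')
    refine h3.congr_deriv ?_
    have hs := Real.sq_sqrt (hD s).le
    have hs0 := Real.sqrt_pos.mpr (hD s)
    have h4 : c * Real.exp (2 * G s) = 2 * x ^ 2 * Real.exp (G s - G T) ^ 2 := by
      rw [hexp]; ring
    rw [h4]
    field_simp
  · have hs := Real.sq_sqrt (hD s).le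
    rw [div_pow, hs, mul_pow, hexp]
    have h5 : Real.exp (2 * G s) * Real.exp (-2 * G s) = 1 := by
      rw [← Real.exp_add]; simp
    have h6 : 2 * (x ^ 2 * (Real.exp (-2 * G T) * Real.exp (2 * G s)) / D s) *
        (Real.exp (-2 * G s) * N s) = c * N s / D s := by
      rw [show 2 * (x ^ 2 * (Real.exp (-2 * G T) * Real.exp (2 * G s)) / D s) *
        (Real.exp (-2 * G s) * N s) = 2 * x ^ 2 * Real.exp (-2 * G T) *
        (Real.exp (2 * G s) * Real.exp (-2 * G s)) * N s / D s by ring, h5, mul_one]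
    rw [h6, div_le_one (hD s)]
    simp only [D]; linarith

namespace IsGoodPath

/-- Complete trajectories of the `k`-th component through prescribed points. -/
theorem exists_trajectory (hf : IsGoodPath K lam f) (k : ℕ+) {T x : ℝ}
    (hx : |x| ≤ radius f k T) : ∃ p : ℝ → ℝ, p T = x ∧
      (∀ s, HasDerivAt p ((equil f s - ((k : ℕ) : ℝ) ^ 4) * p s - p s ^ 3) s) ∧
      ∀ s, |p s| ≤ radius f k s := by
  rw [hf.abs_le_radius_iff, hf.barrier_eq] at hx
  simp_rw [hf.abs_le_radius_iff, hf.barrier_eq]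
  exact exists_bounded_trajectory (hf.hasDerivAt_rate k)
    (hasDerivAt_integral_Iic (hf.continuous_rate k) (hf.integrableOn_exp k))
    (integral_Iic_pos (hf.continuous_rate k) (hf.integrableOn_exp k) fun s => Real.exp_pos _) hx

/-- The complete trajectories of the system inside the attractor. -/
theorem exists_solution (hf : IsGoodPath K lam f) (τ : ℝ) {T : ℝ} {x : H}
    (hx : x ∈ box (equil f T) fun k => radius f k T) : ∃ u : ℝ → H, IsSolution f τ u ∧ u T = x ∧
      ∀ s, u s ∈ box (equil f s) fun k => radius f k s := by
  have hex : ∀ k : ℕ+, ∃ p : ℝ → ℝ, 2 ≤ k → (p T = x k ∧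
      (∀ s, HasDerivAt p ((equil f s - ((k : ℕ) : ℝ) ^ 4) * p s - p s ^ 3) s) ∧
      ∀ s, |p s| ≤ radius f k s) := fun k => by
    by_cases hk : 2 ≤ k
    · obtain ⟨p, hp⟩ := hf.exists_trajectory k (hx.2 k hk)
      exact ⟨p, fun _ => hp⟩
    · exact ⟨0, fun h => absurd h hk⟩
  choose p hp using hex
  let y : ℝ → ℕ+ → ℝ := fun s k => if k = 1 then equil f s else p k s
  have hy1 : ∀ s, y s 1 = equil f s := fun s => if_pos rfl
  have hyk : ∀ s k, 2 ≤ k → y s k = p k s := fun s k hk =>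
    if_neg ((ne_one_iff_two_le k).mpr hk)
  have hbound : ∀ M, 1 ≤ M → ∀ s, (∀ r ∈ Icc (s - 1) s, equil f r ≤ M) → ∀ k,
      |y s k| ≤ Real.exp 1 * M / ((k : ℕ) : ℝ) ^ 2 := by
    intro M hM s hs k
    by_cases hk : k = 1
    · rw [hk, hy1, abs_of_pos (hf.toDissipative.equil_pos s)]
      have h1 := hs s ⟨by linarith, le_rfl⟩
      have h2 : (1 : ℝ) ≤ Real.exp 1 := Real.one_le_exp zero_le_one
      simp only [PNat.one_coe, Nat.cast_one, one_pow, div_one]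
      nlinarith
    · have hk' := (ne_one_iff_two_le k).mp hk
      rw [hyk s k hk']
      exact ((hp k hk').2.2 s).trans (hf.radius_le k hM hs)
  have hM : ∀ a b, ∃ M, 1 ≤ M ∧ ∀ r ∈ Icc a b, equil f r ≤ M := fun a b => by
    obtain ⟨M, hM⟩ := (isCompact_Icc (a := a) (b := b)).bddAbove_image
      hf.toDissipative.continuous_equil.continuousOn
    exact ⟨max 1 M, le_max_left _ _, fun r hr =>
      (hM (mem_image_of_mem _ hr)).trans (le_max_right _ _)⟩
  have hsum : ∀ s, Summable fun k => (y s k) ^ 2 := fun s => by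
    obtain ⟨M, hM1, hM2⟩ := hM (s - 1) s
    exact Summable.of_nonneg_of_le (fun k => sq_nonneg _) (fun k =>
      sq_le_sq.mpr ((hbound M hM1 s hM2 k).trans (le_abs_self _)))
      (summable_sq_div_sq (Real.exp 1 * M))
  let u : ℝ → H := fun s => ofSummable (y s) (hsum s)
  have hpc : ∀ k, 2 ≤ k → Continuous (p k) := fun k hk =>
    continuous_iff_continuousAt.mpr fun s => ((hp k hk).2.1 s).continuousAt
  have hcoord : ∀ k, Continuous fun s => u s k := by
    intro k
    by_cases hk : k = 1
    · subst hk
      exact hf.toDissipative.continuous_equil.congr fun s => (hy1 s).symm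
    · have hk' := (ne_one_iff_two_le k).mp hk
      exact (hpc k hk').congr fun s => (hyk s k hk').symm
  have hucont : Continuous u := by
    refine continuous_iff_continuousAt.mpr fun s => ?_
    -- The coordinate bound at time `r` looks back one unit, so continuity on [s - 1, s + 1] needs
    -- the equilibrium from s - 2 on.
    obtain ⟨M, hM1, hM2⟩ := hM (s - 2) (s + 1)
    have : ContinuousOn u (Icc (s - 1) (s + 1)) :=
      continuousOn_of_coord (summable_sq_div_sq (Real.exp 1 * M)) (fun r hr k =>
        hbound M hM1 r (fun r' hr' => hM2 r' ⟨by linarith [hr.1, hr'.1], hr'.2.trans hr.2⟩) k)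
        fun k => (hcoord k).continuousOn
    exact this.continuousAt (Icc_mem_nhds (by linarith) (by linarith))
  refine ⟨u, ⟨hucont.continuousOn, fun t ht => ?_, fun k hk t ht => ?_⟩, ?_, fun s => ⟨hy1 s, ?_⟩⟩
  · have h := intervalIntegral.integral_eq_sub_of_hasDeriv_right (f := equil f) (a := τ) (b := t)
      (f' := fun s => 1 - f s * equil f s) hf.toDissipative.continuous_equil.continuousOn
      (fun s _ => (hf.toDissipative.hasDerivWithinAt_equil s).mono Ioi_subset_Ici_self)
      (intervalIntegrable_const.sub ((hf.toDissipative.intervalIntegrable τ t).mul_continuousOn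
        hf.toDissipative.continuous_equil.continuousOn))
    simp only [u, ofSummable_apply, hy1]
    rw [h]; ring
  · have h := intervalIntegral.integral_eq_sub_of_hasDerivAt (f := p k) (a := τ) (b := t)
      (fun s _ => (hp k hk).2.1 s) (Continuous.intervalIntegrable (by
        have := hpc k hk
        have := hf.toDissipative.continuous_equil
        fun_prop) _ _)
    simp only [u, ofSummable_apply, hy1, hyk _ k hk]
    have h' : ∫ s in τ..t, (equil f s * p k s - p k s ^ 3 - ((k : ℕ) : ℝ) ^ 4 * p k s) =
        p k t - p k τ := by
      rw [← h]
      congr 1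
      funext s
      ring
    rw [h']; ring
  · refine lp.ext (funext fun k => ?_)
    by_cases hk : k = 1
    · subst hk
      exact (hy1 T).trans hx.1.symm
    · have hk' := (ne_one_iff_two_le k).mp hk
      exact (hyk T k hk').trans (hp k hk').1
  · intro k hk
    have : u s k = p k s := hyk s k hk
    rw [this]
    exact (hp k hk).2.2 s

/-- Invariance of the attractor. -/
theorem evolve_eq (hf : IsGoodPath K lam f) {τ t : ℝ} (ht : τ ≤ t) :
    evolve f t τ (box (equil f τ) fun k => radius f k τ) =
      box (equil f t) fun k => radius f k t := by
  ext x
  constructor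
  · rintro ⟨u, hu, huτ, rfl⟩
    have h1 : ∀ s, τ ≤ s → u s 1 = equil f s := fun s hs => by
      have := hu.sub_equil_eq hf.toDissipative hs
      rw [huτ.1, sub_self, mul_zero, sub_eq_zero] at this
      exact this
    refine ⟨h1 t ht, fun k hk => ?_⟩
    rw [hf.abs_le_radius_iff]
    refine two_mul_sq_mul_le_one (p := fun s => u s k) (J := barrier f k)
      (g := fun r => equil f r - ((k : ℕ) : ℝ) ^ 4) ht
      ((hu.continuousOn_apply k).mono Icc_subset_Ici_self) (fun s hs => ?_)
      (fun s _ => (hf.hasDerivAt_barrier k s).continuousAt.continuousWithinAt)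
      (fun s _ => (hf.hasDerivAt_barrier k s).hasDerivWithinAt) ?_
    · have := hu.hasDerivWithinAt_of_two_le hk hs.1
      rwa [h1 s hs.1] at this
    · exact (hf.abs_le_radius_iff k τ (u τ k)).mp (huτ.2 k hk)
  · intro hx
    obtain ⟨u, hu, hux, hub⟩ := hf.exists_solution τ hx
    exact ⟨u, hu, hub τ, hux⟩

end IsGoodPath

end ToySystem

/-! ### Temperedness and pullback attraction -/

namespace ToySystem

variable {K lam : ℝ} {f : ℝ → ℝ}

theorem tendsto_exp_mul_atBot {c : ℝ} (hc : 0 < c) (C : ℝ) :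
    Tendsto (fun t => C * Real.exp (c * t)) atBot (𝓝 0) := by
  have h1 : Tendsto (fun t : ℝ => c * t) atBot atBot := tendsto_id.const_mul_atBot hc
  simpa using (Real.tendsto_exp_atBot.comp h1).const_mul C

namespace IsGoodPath

/-- The sequence `e / k²`, which up to a factor dominates all points of the attractor. -/
noncomputable def majorant : H :=
  ofSummable (fun k => Real.exp 1 / ((k : ℕ) : ℝ) ^ 2) (summable_sq_div_sq (Real.exp 1))

theorem norm_le_of_mem (hf : IsGoodPath K lam f) {t M : ℝ} (hM : 1 ≤ M)
    (hb : ∀ s ∈ Icc (t - 1) t, equil f s ≤ M) {x : H}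
    (hx : x ∈ box (equil f t) fun k => radius f k t) : ‖x‖ ≤ M * ‖majorant‖ := by
  have hM0 : 0 ≤ M := by linarith
  rw [← abs_of_nonneg hM0, ← Real.norm_eq_abs, ← norm_smul]
  refine norm_le_of_abs_le fun k => ?_
  have h1 : (M • majorant) k = Real.exp 1 * M / ((k : ℕ) : ℝ) ^ 2 := by
    rw [lp.coeFn_smul, Pi.smul_apply, smul_eq_mul, majorant, ofSummable_apply]; ring
  rw [h1, abs_of_nonneg (a := Real.exp 1 * M / _) (by positivity)]
  by_cases hk : k = 1
  · rw [hk, hx.1, abs_of_pos (hf.toDissipative.equil_pos t)]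
    have h1 := hb t ⟨by linarith, le_rfl⟩
    have h2 : (1 : ℝ) ≤ Real.exp 1 := Real.one_le_exp zero_le_one
    simp only [PNat.one_coe, Nat.cast_one, one_pow, div_one]
    nlinarith
  · exact (hx.2 k ((ne_one_iff_two_le k).mp hk)).trans (hf.radius_le k hM hb)

/-- The size of the section at `t` is controlled by the equilibrium on [t - 1, t], which grows
subexponentially in the past. -/
theorem isTemperedFamily_attr (hf : IsGoodPath K lam f) :
    IsTemperedFamily fun t => attr (shift t f) := by
  simp_rw [attr_shift]
  refine ⟨fun t => (hf.isCompact_attr_at t).isBounded, fun θ hθ => ?_⟩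
  obtain ⟨C, hC1, hC⟩ := hf.toDissipative.exists_equil_le (half_pos hθ)
  refine squeeze_zero' (Eventually.of_forall fun t => by positivity) ?_
    (tendsto_exp_mul_atBot (half_pos hθ) (C * Real.exp (θ / 2) * ‖majorant‖))
  filter_upwards [eventually_le_atBot 0] with t ht
  set M := C * Real.exp (θ / 2 * (1 - t))
  have hM : 1 ≤ M := by
    have h1 : 1 ≤ Real.exp (θ / 2 * (1 - t)) := Real.one_le_exp (by nlinarith)
    nlinarith
  have hb : ∀ s ∈ Icc (t - 1) t, equil f s ≤ M := fun s hs => by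
    refine (hC s (hs.2.trans ht)).trans ?_
    exact mul_le_mul_of_nonneg_left (Real.exp_le_exp.mpr (by nlinarith [hs.1])) (by linarith)
  have h1 : |sSup (norm '' box (equil f t) fun k => radius f k t)| ≤ M * ‖majorant‖ := by
    rw [abs_of_nonneg (Real.sSup_nonneg (by rintro _ ⟨x, _, rfl⟩; exact norm_nonneg x))]
    refine Real.sSup_le ?_ (by positivity)
    rintro _ ⟨x, hx, rfl⟩
    exact hf.norm_le_of_mem hM hb hx
  calc _ ≤ Real.exp (θ * t) * (M * ‖majorant‖) := by gcongr
    _ = C * (Real.exp (θ * t) * Real.exp (θ / 2 * (1 - t))) * ‖majorant‖ := by ring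
    _ = C * (Real.exp (θ / 2) * Real.exp (θ / 2 * t)) * ‖majorant‖ := by
        rw [← Real.exp_add, ← Real.exp_add]; congr 3; ring
    _ = _ := by ring

/-- The lower bound for the barrier of solutions starting at time `τ` whose first component differs
from the equilibrium by at most `D exp (-K s)`. -/
noncomputable def approxBarrier (K : ℝ) (f : ℝ → ℝ) (k : ℕ+) (D τ : ℝ) : ℝ :=
  ∫ s in τ..0, Real.exp (-2 * ∫ r in s..0, (equil f r - ((k : ℕ) : ℝ) ^ 4)) *
    Real.exp (-2 * (D * (-s * Real.exp (K * -s))))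

theorem continuous_exp_integral (hf : IsGoodPath K lam f) (k : ℕ+) : Continuous fun s =>
    Real.exp (-2 * ∫ r in s..0, (equil f r - ((k : ℕ) : ℝ) ^ 4)) := by
  have := hf.continuous_rate k
  refine this.congr fun s => ?_
  rw [intervalIntegral.integral_symm]
  congr 1; ring

/-- Dominated convergence: the correction factor is at most 1 because `D` is nonnegative, and for
fixed `s` it tends to 1. -/
theorem tendsto_approxBarrier (hf : IsGoodPath K lam f) (k : ℕ+) {D : ℝ → ℝ}
    (hD : Tendsto D atBot (𝓝 0)) (hD0 : ∀ τ, 0 ≤ D τ) :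
    Tendsto (fun τ => approxBarrier K f k (D τ) τ) atBot (𝓝 (barrier f k 0)) := by
  have hE := hf.continuous_exp_integral k
  have h1 : Tendsto (fun τ => ∫ s in Iic (0 : ℝ), (Ioi τ).indicator (fun s =>
      Real.exp (-2 * ∫ r in s..0, (equil f r - ((k : ℕ) : ℝ) ^ 4)) *
        Real.exp (-2 * (D τ * (-s * Real.exp (K * -s))))) s) atBot (𝓝 (barrier f k 0)) := by
    refine tendsto_integral_filter_of_dominated_convergence _
      (Eventually.of_forall fun τ => ?_) (Eventually.of_forall fun τ => ?_)
      (hf.integrableOn_barrier k 0) ?_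
    · exact (Continuous.aestronglyMeasurable (by fun_prop)).indicator measurableSet_Ioi
    · refine (ae_restrict_iff' measurableSet_Iic).mpr (Eventually.of_forall fun s hs => ?_)
      have hs' : 0 ≤ -s := neg_nonneg.mpr hs
      refine (norm_indicator_le_norm_self _ _).trans ?_
      rw [norm_mul, Real.norm_of_nonneg (Real.exp_pos _).le, Real.norm_of_nonneg (Real.exp_pos _).le]
      refine mul_le_of_le_one_right (Real.exp_pos _).le (Real.exp_le_one_iff.mpr ?_)
      have : 0 ≤ D τ * (-s * Real.exp (K * -s)) :=
        mul_nonneg (hD0 τ) (mul_nonneg hs' (Real.exp_pos _).le)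
      linarith
    · refine Eventually.of_forall fun s => ?_
      have h2 : Tendsto (fun τ => Real.exp (-2 * ∫ r in s..0, (equil f r - ((k : ℕ) : ℝ) ^ 4)) *
          Real.exp (-2 * (D τ * (-s * Real.exp (K * -s))))) atBot
          (𝓝 (Real.exp (-2 * ∫ r in s..0, (equil f r - ((k : ℕ) : ℝ) ^ 4)))) := by
        have h3 := ((hD.mul_const (-s * Real.exp (K * -s))).const_mul (-2)).rexp.const_mul
          (Real.exp (-2 * ∫ r in s..0, (equil f r - ((k : ℕ) : ℝ) ^ 4)))
        simpa using h3
      refine h2.congr' ?_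
      filter_upwards [eventually_lt_atBot s] with τ hτ
      rw [indicator_of_mem (show s ∈ Ioi τ from hτ)]
  refine h1.congr' ?_
  filter_upwards [eventually_le_atBot 0] with τ hτ
  rw [approxBarrier, intervalIntegral.integral_of_le hτ, integral_indicator measurableSet_Ioi,
    Measure.restrict_restrict measurableSet_Ioi, Ioi_inter_Iic]

theorem approxBarrier_le (hf : IsGoodPath K lam f) (k : ℕ+) {D τ : ℝ} (hD : 0 ≤ D) (hτ : τ ≤ 0) :
    approxBarrier K f k D τ ≤ barrier f k 0 := by
  have hE := hf.continuous_exp_integral k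
  calc approxBarrier K f k D τ
      ≤ ∫ s in τ..0, Real.exp (-2 * ∫ r in s..0, (equil f r - ((k : ℕ) : ℝ) ^ 4)) := by
        refine intervalIntegral.integral_mono_on hτ (Continuous.intervalIntegrable (by fun_prop) _ _)
          (hE.intervalIntegrable _ _) fun s hs => ?_
        refine mul_le_of_le_one_right (Real.exp_pos _).le (Real.exp_le_one_iff.mpr ?_)
        have : 0 ≤ D * (-s * Real.exp (K * -s)) :=
          mul_nonneg hD (mul_nonneg (neg_nonneg.mpr hs.2) (Real.exp_pos _).le)
        linarith
    _ ≤ barrier f k 0 := by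
        rw [intervalIntegral.integral_of_le hτ]
        exact setIntegral_mono_set (hf.integrableOn_barrier k 0)
          (Eventually.of_forall fun s => (Real.exp_pos _).le) Ioc_subset_Iic_self.eventuallyLE

/-- On [-1, 0] with D ≤ 1 the perturbation is no worse than adding e^K to the equilibrium. The bound
does not depend on `τ`, and supplies the summable majorant for attraction. -/
theorem le_approxBarrier (hf : IsGoodPath K lam f) (k : ℕ+) {D τ M : ℝ} (hD1 : D ≤ 1)
    (hτ : τ ≤ -1) (hM : 1 ≤ M) (hb : ∀ s ∈ Icc (-1 : ℝ) 0, equil f s + Real.exp K ≤ M) :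
    Real.exp (-2) * ((k : ℕ) : ℝ) ^ 4 / M ^ 2 ≤ approxBarrier K f k D τ := by
  have hE := hf.continuous_exp_integral k
  have hK := hf.toDissipative.K_nonneg
  have hv := hf.toDissipative.continuous_equil
  have h := le_integral_exp (w := fun s => equil f s + Real.exp K) (t := 0)
    (κ := ((k : ℕ) : ℝ) ^ 4) (M := M) (hv.add continuous_const).continuousOn hM
    (by simpa using hb)
  rw [zero_sub] at h
  refine h.2.trans ?_
  calc _ ≤ ∫ s in (-1 : ℝ)..0, Real.exp (-2 * ∫ r in s..0, (equil f r - ((k : ℕ) : ℝ) ^ 4)) *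
        Real.exp (-2 * (D * (-s * Real.exp (K * -s)))) := by
        refine intervalIntegral.integral_mono_on (by norm_num) h.1
          (Continuous.intervalIntegrable (by fun_prop) _ _) fun s hs => ?_
        rw [← Real.exp_add]
        refine Real.exp_le_exp.mpr ?_
        have h1 : ∫ r in s..0, (equil f r + Real.exp K - ((k : ℕ) : ℝ) ^ 4) =
            (∫ r in s..0, (equil f r - ((k : ℕ) : ℝ) ^ 4)) + (-s) * Real.exp K := by
          have h2 : ∀ r, equil f r + Real.exp K - ((k : ℕ) : ℝ) ^ 4 =
            (equil f r - ((k : ℕ) : ℝ) ^ 4) + Real.exp K := fun r => by ring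
          simp_rw [h2]
          rw [intervalIntegral.integral_add (Continuous.intervalIntegrable (by fun_prop) _ _)
            intervalIntegrable_const, intervalIntegral.integral_const, smul_eq_mul, zero_sub]
        have hs0 : 0 ≤ -s := neg_nonneg.mpr hs.2
        have h3 : Real.exp (K * -s) ≤ Real.exp K :=
          Real.exp_le_exp.mpr (mul_le_of_le_one_right hK (by linarith [hs.1]))
        have h4 : D * (-s * Real.exp (K * -s)) ≤ -s * Real.exp K :=
          (mul_le_of_le_one_left (mul_nonneg hs0 (Real.exp_pos _).le) hD1).trans
            (mul_le_mul_of_nonneg_left h3 hs0)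
        rw [h1]
        linarith
    _ ≤ approxBarrier K f k D τ := by
        refine intervalIntegral.integral_mono_interval hτ (by norm_num) le_rfl
          (Eventually.of_forall fun s => by positivity)
          (Continuous.intervalIntegrable (by fun_prop) _ _)

/-- The discrepancy of the first component at time `r` is at most D e^{-Kr}, since going back from 0
costs at most the rate `K`. So the integrated growth rate over [s, 0] exceeds that of the
equilibrium by at most D(-s)e^{-Ks}, and the solution's own barrier dominates the approximate one.
-/
theorem two_mul_sq_mul_approxBarrier_le (hf : IsGoodPath K lam f) {k : ℕ+} (hk : 2 ≤ k)
    {D τ : ℝ} (hτ : τ ≤ 0) {u : ℝ → H} (hu : IsSolution f τ u)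
    (hD : Real.exp (-∫ r in τ..0, f r) * |u τ 1 - equil f τ| ≤ D) :
    2 * u 0 k ^ 2 * approxBarrier K f k D τ ≤ 1 := by
  have hE := hf.continuous_exp_integral k
  have hv := hf.toDissipative.continuous_equil
  have hK := hf.toDissipative.K_nonneg
  have hu1 : ContinuousOn (fun r => u r 1) (Icc τ 0) :=
    (hu.continuousOn_apply 1).mono Icc_subset_Ici_self
  have hdiff : ∀ r ∈ Icc τ 0, u r 1 - equil f r ≤ D * Real.exp (K * -r) := by
    intro r hr
    rw [hu.sub_equil_eq hf.toDissipative hr.1]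
    have h1 : -∫ r in τ..r, f r ≤ (-∫ r in τ..0, f r) + K * -r := by
      have h2 := (abs_le.mp (hf.toDissipative.abs_integral_le r 0)).2
      rw [hf.toDissipative.integral_eq_sub r 0, zero_sub, abs_of_nonneg (by linarith [hr.2])] at h2
      rw [hf.toDissipative.integral_eq_sub τ r, hf.toDissipative.integral_eq_sub τ 0]
      linarith
    calc _ ≤ Real.exp ((-∫ r in τ..0, f r) + K * -r) * |u τ 1 - equil f τ| := by
          exact (mul_le_mul_of_nonneg_left (le_abs_self _) (Real.exp_pos _).le).trans
            (mul_le_mul_of_nonneg_right (Real.exp_le_exp.mpr h1) (abs_nonneg _))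
      _ = (Real.exp (-∫ r in τ..0, f r) * |u τ 1 - equil f τ|) * Real.exp (K * -r) := by
          rw [Real.exp_add]; ring
      _ ≤ D * Real.exp (K * -r) := by gcongr
  refine le_trans ?_ (hu.two_mul_sq_mul_le hk hτ)
  refine mul_le_mul_of_nonneg_left ?_ (by positivity)
  have hg : ContinuousOn (fun r => u r 1 - ((k : ℕ) : ℝ) ^ 4) (Icc τ 0) :=
    hu1.sub continuousOn_const
  have hii : ∀ s ∈ Icc τ 0, ∀ s' ∈ Icc τ 0,
      IntervalIntegrable (fun r => u r 1 - ((k : ℕ) : ℝ) ^ 4) volume s s' := fun s hs s' hs' =>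
    (hg.mono (uIcc_subset_Icc hs hs')).intervalIntegrable
  have hτm : τ ∈ Icc τ 0 := left_mem_Icc.mpr hτ
  have h0m : (0 : ℝ) ∈ Icc τ 0 := right_mem_Icc.mpr hτ
  have hcont : ContinuousOn (fun s => Real.exp (-2 * ∫ r in s..0, (u r 1 - ((k : ℕ) : ℝ) ^ 4)))
      (Icc τ 0) := by
    have h1 := (exists_primitive hτ hg).1
    have h2 : ContinuousOn (fun s => Real.exp (-2 * ((∫ r in τ..0, (u r 1 - ((k : ℕ) : ℝ) ^ 4)) -
        ∫ r in τ..s, (u r 1 - ((k : ℕ) : ℝ) ^ 4)))) (Icc τ 0) := by fun_prop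
    refine h2.congr fun s hs => ?_
    simp only [intervalIntegral.integral_interval_sub_left (hii τ hτm 0 h0m) (hii τ hτm s hs)]
  refine intervalIntegral.integral_mono_on hτ (Continuous.intervalIntegrable (by fun_prop) _ _)
    (by rw [← uIcc_of_le hτ] at hcont; exact hcont.intervalIntegrable) fun s hs => ?_
  rw [← Real.exp_add]
  refine Real.exp_le_exp.mpr ?_
  have hs0 : 0 ≤ -s := neg_nonneg.mpr hs.2
  have hD0 : 0 ≤ D := le_trans (by positivity) hD
  have h1 : ∫ r in s..0, (u r 1 - ((k : ℕ) : ℝ) ^ 4) ≤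
      ∫ r in s..0, ((equil f r - ((k : ℕ) : ℝ) ^ 4) + D * Real.exp (K * -s)) := by
    refine intervalIntegral.integral_mono_on hs.2 (hii s hs 0 h0m)
      (Continuous.intervalIntegrable (by fun_prop) _ _) fun r hr => ?_
    have h2 := hdiff r ⟨hs.1.trans hr.1, hr.2⟩
    have h3 : D * Real.exp (K * -r) ≤ D * Real.exp (K * -s) := by
      refine mul_le_mul_of_nonneg_left (Real.exp_le_exp.mpr ?_) hD0
      exact mul_le_mul_of_nonneg_left (by linarith [hr.1]) hK
    linarith
  rw [intervalIntegral.integral_add (Continuous.intervalIntegrable (by fun_prop) _ _)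
            intervalIntegrable_const, intervalIntegral.integral_const, smul_eq_mul, zero_sub] at h1
  linarith

/-- The endpoint is compared with its projection onto the box. The first coordinate is off by at
most `D τ`, the others by at most R_k - r_k. Each of these tends to 0 under a common majorant of
order k⁻², hence so does the sum of squares. -/
theorem tendsto_semiDist (hf : IsGoodPath K lam f) {B : ℝ → Set H} (hB : IsTemperedFamily B) :
    Tendsto (fun τ => semiDist (evolve f 0 τ (B τ)) (attr f)) atBot (𝓝 0) := by
  obtain ⟨hbdd, htemp⟩ := hB
  set β : ℝ → ℝ := fun t => sSup (norm '' B t)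
  let D : ℝ → ℝ := fun τ => Real.exp (-∫ r in τ..0, f r) * (|β τ| + equil f τ)
  have hpos := hf.toDissipative.equil_pos
  have hlam := hf.lam_pos
  have hD0 : ∀ τ, 0 ≤ D τ := fun τ =>
    mul_nonneg (Real.exp_pos _).le (add_nonneg (abs_nonneg _) (hpos τ).le)
  have hD : Tendsto D atBot (𝓝 0) := by
    -- The decay rate lam/2 obtained from the mean beats the tempered size of `B` and the growth
    -- rate lam/4 allowed for the equilibrium.
    obtain ⟨C, hC⟩ := hf.toDissipative.exists_mean_bound (half_pos hlam)
    obtain ⟨C', _, hC'⟩ := hf.toDissipative.exists_equil_le (ε := lam / 4) (by linarith)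
    have h1 := ((htemp (lam / 2) (half_pos hlam)).add
      (tendsto_exp_mul_atBot (c := lam / 4) (by linarith) C')).const_mul (Real.exp C)
    rw [add_zero, mul_zero] at h1
    refine squeeze_zero' (Eventually.of_forall hD0) ?_ h1
    filter_upwards [eventually_le_atBot 0] with τ hτ
    have h2 : -∫ r in τ..0, f r ≤ C + lam / 2 * τ := by
      have := (abs_le.mp (hC τ hτ)).2
      rw [intervalIntegral.integral_symm] at this
      linarith
    calc D τ ≤ Real.exp (C + lam / 2 * τ) * (|β τ| + C' * Real.exp (-(lam / 4 * τ))) := by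
          refine mul_le_mul (Real.exp_le_exp.mpr h2) (add_le_add le_rfl (hC' τ hτ))
            (add_nonneg (abs_nonneg _) (hpos τ).le) (Real.exp_pos _).le
      _ = Real.exp C * (Real.exp (lam / 2 * τ) * |β τ| +
            C' * (Real.exp (lam / 2 * τ) * Real.exp (-(lam / 4 * τ)))) := by
          rw [Real.exp_add]; ring
      _ = _ := by rw [← Real.exp_add]; congr 4; ring
  obtain ⟨M, hM1, hM⟩ : ∃ M, 1 ≤ M ∧ ∀ s ∈ Icc (-1 : ℝ) 0, equil f s + Real.exp K ≤ M := by
    obtain ⟨M, hM⟩ := (isCompact_Icc (a := (-1 : ℝ)) (b := 0)).bddAbove_image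
      (hf.toDissipative.continuous_equil.add (continuous_const (y := Real.exp K))).continuousOn
    exact ⟨max 1 M, le_max_left _ _, fun r hr =>
      (hM (mem_image_of_mem _ hr)).trans (le_max_right _ _)⟩
  let R : ℕ+ → ℝ → ℝ := fun k τ => (√(2 * approxBarrier K f k (D τ) τ))⁻¹
  let d : ℝ → ℕ+ → ℝ := fun τ k => if k = 1 then D τ else R k τ - radius f k 0
  have hev : ∀ᶠ τ in atBot, D τ ≤ 1 ∧ τ ≤ -1 :=
    (hD.eventually_le_const one_pos).and (eventually_le_atBot (-1))
  have hApos : ∀ τ, D τ ≤ 1 ∧ τ ≤ -1 → ∀ k : ℕ+, 0 < approxBarrier K f k (D τ) τ := by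
    intro τ hτ k
    have hk : (0 : ℝ) < (k : ℕ) := by exact_mod_cast k.pos
    exact lt_of_lt_of_le (by positivity) (hf.le_approxBarrier k hτ.1 hτ.2 hM1 hM)
  have hrR : ∀ τ, D τ ≤ 1 ∧ τ ≤ -1 → ∀ k : ℕ+, radius f k 0 ≤ R k τ := by
    intro τ hτ k
    have h1 := hApos τ hτ k
    have h2 := hf.approxBarrier_le k (hD0 τ) (by linarith [hτ.2] : τ ≤ 0)
    exact inv_anti₀ (by positivity) (Real.sqrt_le_sqrt (by linarith))
  have hd : ∀ τ, D τ ≤ 1 ∧ τ ≤ -1 → ∀ k : ℕ+,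
      0 ≤ d τ k ∧ d τ k ≤ Real.exp 1 * M / ((k : ℕ) : ℝ) ^ 2 := by
    intro τ hτ k
    by_cases hk : k = 1
    · simp only [d, if_pos hk]
      refine ⟨hD0 τ, hτ.1.trans ?_⟩
      have h2 : (1 : ℝ) ≤ Real.exp 1 := Real.one_le_exp zero_le_one
      simp only [hk, PNat.one_coe, Nat.cast_one, one_pow, div_one]
      nlinarith
    · simp only [d, if_neg hk]
      have hk0 : (0 : ℝ) < (k : ℕ) := by exact_mod_cast k.pos
      have h1 := inv_sqrt_two_mul_le hk0 (by linarith) (hf.le_approxBarrier k hτ.1 hτ.2 hM1 hM)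
      have h2 := radius_nonneg f k 0
      exact ⟨by linarith [hrR τ hτ k], by linarith⟩
  have hS : Tendsto (fun τ => ∑' k, d τ k ^ 2) atBot (𝓝 0) := by
    have h1 := tendsto_tsum_of_dominated_convergence (f := fun τ k => d τ k ^ 2)
      (g := fun _ => (0 : ℝ)) (𝓕 := atBot) (summable_sq_div_sq (Real.exp 1 * M)) (fun k => ?_) ?_
    · simpa using h1
    · by_cases hk : k = 1
      · simp only [d, if_pos hk]
        simpa using hD.pow 2
      · simp only [d, if_neg hk]
        have h2 := ((hf.tendsto_approxBarrier k hD hD0).const_mul 2).sqrt.inv₀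
          (by have := hf.barrier_pos k 0; positivity)
        have h3 : Tendsto (fun τ => (R k τ - radius f k 0) ^ 2) atBot
          (𝓝 ((radius f k 0 - radius f k 0) ^ 2)) := (h2.sub_const _).pow 2
        simpa using h3
    · filter_upwards [hev] with τ hτ k
      rw [Real.norm_of_nonneg (sq_nonneg _)]
      exact pow_le_pow_left₀ (hd τ hτ k).1 (hd τ hτ k).2 2
  have hS' : Tendsto (fun τ => ENNReal.ofReal √(∑' k, d τ k ^ 2)) atBot (𝓝 0) := by
    simpa using ENNReal.tendsto_ofReal hS.sqrt
  refine tendsto_of_tendsto_of_tendsto_of_le_of_le' tendsto_const_nhds hS'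
    (Eventually.of_forall fun _ => zero_le) ?_
  filter_upwards [hev] with τ hτ
  have hτ0 : τ ≤ 0 := by linarith [hτ.2]
  refine iSup₂_le ?_
  rintro _ ⟨u, hu, huB, rfl⟩
  have hr0 : ∀ k : ℕ+, 2 ≤ k → 0 ≤ radius f k 0 := fun k _ => radius_nonneg f k 0
  refine (Metric.infEDist_le_edist_of_mem (proj_mem hr0 (u 0) : _ ∈ attr f)).trans ?_
  rw [edist_dist]
  refine ENNReal.ofReal_le_ofReal (Real.le_sqrt_of_sq_le ?_)
  rw [dist_eq_norm]
  have hbd : BddAbove (norm '' B τ) := by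
    obtain ⟨c, hc⟩ := isBounded_iff_forall_norm_le.mp (hbdd τ)
    exact ⟨c, by rintro _ ⟨x, hx, rfl⟩; exact hc x hx⟩
  have hnorm : ‖u τ‖ ≤ |β τ| :=
    (le_csSup hbd (mem_image_of_mem _ huB)).trans (le_abs_self _)
  have hDu : Real.exp (-∫ r in τ..0, f r) * |u τ 1 - equil f τ| ≤ D τ := by
    refine mul_le_mul_of_nonneg_left ((abs_sub _ _).trans ?_) (Real.exp_pos _).le
    rw [abs_of_pos (hpos τ)]
    exact add_le_add ((abs_apply_le_norm _ _).trans hnorm) le_rfl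
  have hsumd : Summable fun k => d τ k ^ 2 :=
    Summable.of_nonneg_of_le (fun k => sq_nonneg _)
      (fun k => pow_le_pow_left₀ (hd τ hτ k).1 (hd τ hτ k).2 2)
      (summable_sq_div_sq (Real.exp 1 * M))
  refine hasSum_le (fun k => ?_) (hasSum_sq _) hsumd.hasSum
  refine sq_le_sq.mpr (le_trans ?_ (le_abs_self _))
  rw [lp.coeFn_sub, Pi.sub_apply]
  change |u 0 k - clamp (equil f 0) (fun k => radius f k 0) (u 0) k| ≤ _
  by_cases hk : k = 1
  · simp only [d, if_pos hk, clamp]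
    rw [hk, hu.sub_equil_eq hf.toDissipative hτ0, abs_mul, abs_of_pos (Real.exp_pos _)]
    exact hDu
  · have hk' := (ne_one_iff_two_le k).mp hk
    simp only [d, if_neg hk]
    refine abs_sub_clamp_le hk' ?_ (hrR τ hτ k) (hr0 k hk')
    exact (inv_sqrt_two_mul_iff (hApos τ hτ k)).mpr
      (hf.two_mul_sq_mul_approxBarrier_le hk' hτ0 hu hDu)

end IsGoodPath

end ToySystem

/-! ### Bernoulli damping: laws of large numbers and infinite mean -/

namespace ToySystem
open ProbabilityTheory

section Damping

variable {a b : ℝ}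

theorem abs_coe_le (ha : 0 < a) (hb : 0 < b) (x : ({a, -b} : Set ℝ)) : |(x : ℝ)| ≤ max a b := by
  rcases x.2 with h | h
  · rw [h, abs_of_pos ha]; exact le_max_left _ _
  · rw [mem_singleton_iff.mp h, abs_neg, abs_of_pos hb]; exact le_max_right _ _

theorem measurable_damping (η : BernoulliScheme a b) : Measurable (damping η) :=
  (measurable_of_countable fun n : ℤ => (η n : ℝ)).comp Int.measurable_floor

theorem damping_of_mem_Ico (η : BernoulliScheme a b) {n : ℤ} {t : ℝ}
    (ht : t ∈ Ico (n : ℝ) (n + 1)) : damping η t = η n := by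
  rw [damping, Int.floor_eq_iff.mpr ht]

theorem rightCts_damping (η : BernoulliScheme a b) (t : ℝ) :
    ContinuousWithinAt (damping η) (Ici t) t := by
  refine (continuousWithinAt_const (b := (η ⌊t⌋ : ℝ))).congr_of_eventuallyEq ?_ rfl
  filter_upwards [Ico_mem_nhdsGE (Int.lt_floor_add_one t)] with s hs
  exact damping_of_mem_Ico η ⟨(Int.floor_le t).trans hs.1, hs.2⟩

theorem intervalIntegrable_damping (ha : 0 < a) (hb : 0 < b) (η : BernoulliScheme a b) (s t : ℝ) :
    IntervalIntegrable (damping η) volume s t :=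
  (intervalIntegrable_const (c := max a b)).mono_fun (measurable_damping η).aestronglyMeasurable
    (Eventually.of_forall fun t => by
      have : 0 ≤ max a b := ha.le.trans (le_max_left _ _)
      simpa only [Real.norm_eq_abs, abs_of_nonneg this, damping] using abs_coe_le ha hb (η ⌊t⌋))

theorem integral_damping_unit (η : BernoulliScheme a b) (n : ℤ) :
    ∫ r in (n : ℝ)..(n + 1 : ℝ), damping η r = η n := by
  have h : ∫ r in (n : ℝ)..(n + 1 : ℝ), damping η r = ∫ _ in (n : ℝ)..(n + 1 : ℝ), (η n : ℝ) := by
    refine intervalIntegral.integral_congr_ae ?_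
    have h1 : ∀ᵐ r : ℝ, r ≠ n + 1 := by
      simp [ae_iff]
    filter_upwards [h1] with r hr hmem
    rw [uIoc_of_le (by linarith)] at hmem
    exact damping_of_mem_Ico η ⟨hmem.1.le, lt_of_le_of_ne hmem.2 hr⟩
  rw [h, intervalIntegral.integral_const]
  simp

theorem integral_damping (ha : 0 < a) (hb : 0 < b) (η : BernoulliScheme a b) (p : ℤ) (n : ℕ) :
    ∫ r in (p : ℝ)..(p + n : ℝ), damping η r = ∑ i ∈ Finset.range n, (η (p + i) : ℝ) := by
  induction n with
  | zero => simp
  | succ n ih =>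
    rw [Finset.sum_range_succ, ← ih, ← integral_damping_unit η (p + n)]
    push_cast
    rw [intervalIntegral.integral_add_adjacent_intervals (intervalIntegrable_damping ha hb η _ _)
      (intervalIntegrable_damping ha hb η _ _)]
    ring_nf

end Damping

section Probability

variable {a b : ℝ} {q : unitInterval}

instance : IsProbabilityMeasure (bernoulliProd a b q) := by
  unfold bernoulliProd; infer_instance

theorem iIndepFun_coe (a b : ℝ) (q : unitInterval) :
    iIndepFun (fun (i : ℤ) (η : BernoulliScheme a b) => (η i : ℝ)) (bernoulliProd a b q) :=
  iIndepFun_infinitePi (X := fun (_ : ℤ) (x : ({a, -b} : Set ℝ)) => (x : ℝ))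
    fun _ => measurable_subtype_coe

theorem measurable_coe_apply (i : ℤ) : Measurable fun η : BernoulliScheme a b => (η i : ℝ) :=
  measurable_subtype_coe.comp (measurable_pi_apply i)

theorem integral_comp_apply (φ : ℝ → ℝ) (hφ : Measurable φ) (i : ℤ) :
    ∫ η, φ (η i) ∂(bernoulliProd a b q) = q * φ a + (1 - q) * φ (-b) := by
  have h := (measurePreserving_eval_infinitePi (fun _ : ℤ =>
    bernoulliMeasure (⟨a, by simp⟩ : ({a, -b} : Set ℝ)) (⟨-b, by simp⟩ : ({a, -b} : Set ℝ)) q) i)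
  have h2 := integral_map (μ := bernoulliProd a b q) h.measurable.aemeasurable
    (f := fun x : ({a, -b} : Set ℝ) => φ x)
    (hφ.comp measurable_subtype_coe).aestronglyMeasurable
  have h3 : (bernoulliProd a b q).map (Function.eval i) = _ := h.map_eq
  rw [h3, integral_bernoulliMeasure] at h2
  simpa using h2.symm

/-- The sum of the damping rates over the `j`-th block of length `m` in the past. -/
def blockSum (m j : ℕ) (η : BernoulliScheme a b) : ℝ :=
  ∑ i ∈ Finset.range m, (η (-((j + 1) * m : ℤ) + i) : ℝ)

theorem measurable_blockSum (m j : ℕ) :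
    Measurable (blockSum m j : BernoulliScheme a b → ℝ) :=
  Finset.measurable_sum _ fun _ _ => measurable_coe_apply _

/-- The strong law of large numbers for functions of blocks of the past. -/
theorem ae_tendsto_blockSum (ha : 0 < a) (hb : 0 < b) (m : ℕ) {ψ : ℝ → ℝ} (hψ : Continuous ψ) :
    ∀ᵐ η ∂(bernoulliProd a b q), Tendsto
      (fun n : ℕ => (∑ j ∈ Finset.range n, ψ (blockSum m j η)) / n) atTop
      (𝓝 (∫ η, ψ (blockSum m 0 η) ∂(bernoulliProd a b q))) := by
  refine strong_law_ae_real (fun j η => ψ (blockSum m j η)) ?_ ?_ ?_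
  · obtain ⟨C, hC⟩ := (isCompact_Icc (a := -(m * max a b)) (b := m * max a b)).exists_bound_of_continuousOn
      hψ.continuousOn
    refine Integrable.of_bound (hψ.measurable.comp (measurable_blockSum m 0)).aestronglyMeasurable C
      (Eventually.of_forall fun η => hC _ (abs_le.mp ?_))
    refine (Finset.abs_sum_le_sum_abs _ _).trans ?_
    refine (Finset.sum_le_card_nsmul _ _ (max a b) fun i _ => abs_coe_le ha hb _).trans ?_
    simp
  · intro j j' hjj'
    -- Distinct blocks read disjoint sets of coordinates, hence are independent.
    let S : ℕ → Finset ℤ := fun j => (Finset.range m).image fun i : ℕ => -((j + 1) * m : ℤ) + i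
    have hdisj : Disjoint (S j) (S j') := by
      rw [Finset.disjoint_left]
      intro x hx hx'
      simp only [S, Finset.mem_image, Finset.mem_range] at hx hx'
      obtain ⟨i, hi, rfl⟩ := hx
      obtain ⟨i', hi', h⟩ := hx'
      apply hjj'
      have hi0 : (i : ℤ) < m := by exact_mod_cast hi
      have hi0' : (i' : ℤ) < m := by exact_mod_cast hi'
      rcases lt_trichotomy j j' with hlt | heq | hlt
      · have : ((j + 1 : ℕ) : ℤ) * m ≤ j' * m := by exact_mod_cast Nat.mul_le_mul_right m hlt
        push_cast at this
        nlinarith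
      · exact heq
      · have : ((j' + 1 : ℕ) : ℤ) * m ≤ j * m := by exact_mod_cast Nat.mul_le_mul_right m hlt
        push_cast at this
        nlinarith
    have hind := (iIndepFun_coe a b q).indepFun_finset (S j) (S j') hdisj measurable_coe_apply
    have hmem : ∀ j, ∀ i : Fin m, -((j + 1 : ℕ) * m : ℤ) + (i : ℕ) ∈ S j := fun j i => by
      simp only [S, Finset.mem_image, Finset.mem_range]
      exact ⟨i, i.2, by push_cast; ring⟩
    have hcomp : ∀ j, (fun η : BernoulliScheme a b => ψ (blockSum m j η)) =
        (fun x : S j → ℝ => ψ (∑ i : Fin m, x ⟨_, hmem j i⟩)) ∘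
          fun η (i : S j) => (η i : ℝ) := fun j => by
      funext η
      simp only [Function.comp, blockSum]
      rw [Finset.sum_range]
      push_cast
      rfl
    simp only [Function.onFun]
    rw [hcomp j, hcomp j']
    refine hind.comp ?_ ?_ <;>
    exact hψ.measurable.comp (Finset.measurable_sum _ fun _ _ => measurable_pi_apply _)
  · intro j
    -- Translating indices by j·m preserves the product measure and carries block 0 to block `j`, so
    -- all blocks have the same law.
    let σ : BernoulliScheme a b → BernoulliScheme a b := fun η i => η (i - j * m)
    have hσm : Measurable σ := measurable_pi_lambda _ fun i => measurable_pi_apply _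
    have hσ : (bernoulliProd a b q).map σ = bernoulliProd a b q :=
      Measure.map_infinitePi_infinitePi_of_inj (f := fun i : ℤ => i - j * m)
        (P := fun _ : ℤ => bernoulliMeasure (⟨a, by simp⟩ : ({a, -b} : Set ℝ))
          (⟨-b, by simp⟩ : ({a, -b} : Set ℝ)) q) sub_left_injective
    have h0 : Measurable fun η : BernoulliScheme a b => ψ (blockSum m 0 η) :=
      hψ.measurable.comp (measurable_blockSum m 0)
    have hcomp : (fun η : BernoulliScheme a b => ψ (blockSum m j η)) =
        (fun η => ψ (blockSum m 0 η)) ∘ σ := by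
      funext η
      simp only [Function.comp, blockSum, σ]
      congr 1
      refine Finset.sum_congr rfl fun i _ => ?_
      congr 2
      push_cast; ring
    refine ⟨(hψ.measurable.comp (measurable_blockSum m j)).aemeasurable, h0.aemeasurable, ?_⟩
    rw [hcomp, ← Measure.map_map h0 hσm, hσ]

theorem integral_blockSum_one :
    ∫ η, blockSum 1 0 η ∂(bernoulliProd a b q) = q * a + (1 - q) * (-b) := by
  have := integral_comp_apply (a := a) (b := b) (q := q) id measurable_id (-1)
  simpa [blockSum] using this

/-- Independence factors the expectation into `m` equal moment generating functions at -1. -/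
theorem integral_exp_neg_blockSum (m : ℕ) :
    ∫ η, Real.exp (-blockSum m 0 η) ∂(bernoulliProd a b q) =
      (q * Real.exp (-a) + (1 - q) * Real.exp b) ^ m := by
  have h1 : iIndepFun (fun (i : ℕ) (η : BernoulliScheme a b) => (η (-m + i) : ℝ))
      (bernoulliProd a b q) :=
    (iIndepFun_coe a b q).precomp (g := fun i : ℕ => (-m + i : ℤ)) (fun i j h => by simpa using h)
  have h2 := h1.mgf_sum (t := -1) (fun i => measurable_coe_apply _) (Finset.range m)
  have h3 : ∀ i ∈ Finset.range m, mgf (fun η : BernoulliScheme a b => (η (-m + i) : ℝ))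
      (bernoulliProd a b q) (-1) = q * Real.exp (-a) + (1 - q) * Real.exp b := fun i _ => by
    have := integral_comp_apply (a := a) (b := b) (q := q) (fun x => Real.exp (-1 * x))
      (by fun_prop) (-m + i)
    simpa [mgf] using this
  rw [Finset.prod_congr rfl h3, Finset.prod_const, Finset.card_range] at h2
  rw [← h2, mgf]
  simp [blockSum]

end Probability

section Path

variable {a b : ℝ}

theorem integral_block (ha : 0 < a) (hb : 0 < b) (η : BernoulliScheme a b) (m j : ℕ) :
    ∫ r in (-((j + 1) * m) : ℝ)..(-(j * m) : ℝ), damping η r = blockSum m j η := by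
  have := integral_damping ha hb η (-((j + 1) * m)) m
  rw [blockSum, ← this]
  push_cast
  ring_nf

theorem sum_integral_blocks {g : ℝ → ℝ} (hg : ∀ s t, IntervalIntegrable g volume s t) (m n : ℕ) :
    ∑ j ∈ Finset.range n, ∫ r in (-((j + 1) * m) : ℝ)..(-(j * m) : ℝ), g r =
      ∫ r in (-(n * m) : ℝ)..0, g r := by
  induction n with
  | zero => simp
  | succ n ih =>
    rw [Finset.sum_range_succ, ih, add_comm]
    push_cast
    rw [intervalIntegral.integral_add_adjacent_intervals (hg _ _) (hg _ _)]

/-- Real times are rounded to integers; the leftover interval has length at most 1, so its share of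
the mean vanishes. -/
theorem tendsto_mean_damping (ha : 0 < a) (hb : 0 < b) (η : BernoulliScheme a b) {lam : ℝ}
    (h : Tendsto (fun n : ℕ => (∑ j ∈ Finset.range n, blockSum 1 j η) / n) atTop (𝓝 lam)) :
    Tendsto (fun s => (∫ r in s..0, damping η r) / (-s)) atBot (𝓝 lam) := by
  have hi := intervalIntegrable_damping ha hb η
  have h1 : Tendsto (fun x : ℝ => (∫ r in (-(⌊x⌋₊ : ℝ))..0, damping η r) / ⌊x⌋₊ * (⌊x⌋₊ / x)) atTop
      (𝓝 (lam * 1)) := by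
    refine Tendsto.mul ?_ tendsto_nat_floor_div_atTop
    refine (h.comp tendsto_nat_floor_atTop).congr fun x => ?_
    simp only [Function.comp]
    simp_rw [← integral_block ha hb η]
    rw [sum_integral_blocks hi]
    simp
  have h2 : Tendsto (fun x : ℝ => (∫ r in (-x)..(-(⌊x⌋₊ : ℝ)), damping η r) / x) atTop (𝓝 0) := by
    refine squeeze_zero_norm' ?_ ((tendsto_const_nhds (x := max a b)).div_atTop tendsto_id)
    filter_upwards [eventually_gt_atTop 0] with x hx
    rw [norm_div, Real.norm_of_nonneg hx.le]
    refine div_le_div_of_nonneg_right ?_ hx.le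
    have h3 := intervalIntegral.norm_integral_le_of_norm_le_const (f := damping η)
      (a := -x) (b := -(⌊x⌋₊ : ℝ)) (C := max a b) fun t _ => abs_coe_le ha hb (η ⌊t⌋)
    refine h3.trans (mul_le_of_le_one_right (ha.le.trans (le_max_left _ _)) ?_)
    have h4 := Nat.floor_le hx.le
    have h5 := Nat.lt_floor_add_one x
    rw [abs_le]
    constructor <;> linarith
  have h3 := (h1.add h2).comp tendsto_neg_atBot_atTop
  rw [mul_one, add_zero] at h3
  refine h3.congr' ?_
  filter_upwards [eventually_lt_atBot (-1)] with s hs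
  have hfl : (0 : ℝ) < ⌊-s⌋₊ := by
    have : 1 ≤ ⌊-s⌋₊ := Nat.le_floor (by push_cast; linarith)
    exact_mod_cast this
  simp only [Function.comp, neg_neg]
  rw [div_mul_div_cancel₀ hfl.ne', ← add_div, add_comm,
    intervalIntegral.integral_add_adjacent_intervals (hi _ _) (hi _ _)]

/-- On the last unit of each block the equilibrium is at least c·exp(-blockSum). The averages of
these exponentials tend to ρ^m, and since ρ > 1 the yield c·ρ^m per block outgrows the block length
`m`. -/
theorem growth_of_blocks {K lam : ℝ} (ha : 0 < a) (hb : 0 < b) (η : BernoulliScheme a b) {ρ : ℝ}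
    (hη : IsDissipativePath K lam (damping η)) (hρ : 1 < ρ)
    (h : ∀ m : ℕ, Tendsto (fun n : ℕ => (∑ j ∈ Finset.range n, Real.exp (-blockSum m j η)) / n)
      atTop (𝓝 (ρ ^ m))) (C : ℝ) :
    ∀ᶠ s in atBot, C * (-s) ≤ ∫ r in s..0, equil (damping η) r := by
  set f := damping η
  -- One factor e^{-K} bounds the equilibrium at the start of the block, the other pays for the part
  -- of the block after `t`.
  set c : ℝ := Real.exp (-(2 * K))
  have hc : 0 < c := Real.exp_pos _
  have hK := hη.K_nonneg
  -- The 4 is spent twice: once on replacing the limit ρ^m by ρ^m/2, once on rounding, through n + 1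
  -- ≤ 2n.
  obtain ⟨m, hm1, hm⟩ : ∃ m : ℕ, 1 ≤ m ∧ 4 * |C| * m ≤ c * ρ ^ m := by
    have h1 := (tendsto_pow_const_div_const_pow_of_one_lt 1 hρ).const_mul (4 * |C|)
    rw [mul_zero] at h1
    obtain ⟨m, hm, hm'⟩ := ((h1.eventually_le_const hc).and (eventually_ge_atTop 1)).exists
    refine ⟨m, hm', ?_⟩
    rw [pow_one, ← mul_div_assoc, div_le_iff₀ (by positivity)] at hm
    exact hm
  have hm0 : (0 : ℝ) < m := by exact_mod_cast hm1
  have hm1' : (1 : ℝ) ≤ m := by exact_mod_cast hm1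
  have hblock : ∀ j : ℕ, c * Real.exp (-blockSum m j η) ≤
      ∫ r in (-((j + 1) * m) : ℝ)..(-(j * m) : ℝ), equil f r := by
    intro j
    have hle : (-(j * m) - 1 : ℝ) ≤ -(j * m) := by linarith
    calc c * Real.exp (-blockSum m j η)
        = ∫ _ in (-(j * m) - 1 : ℝ)..(-(j * m) : ℝ), c * Real.exp (-blockSum m j η) := by simp
      _ ≤ ∫ r in (-(j * m) - 1 : ℝ)..(-(j * m) : ℝ), equil f r := by
          refine intervalIntegral.integral_mono_on hle intervalIntegrable_const
            (hη.intervalIntegrable_equil _ _) fun t ht => ?_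
          have h0 : (-((j + 1) * m) : ℝ) ≤ t := by linarith [ht.1]
          refine le_trans ?_ (hη.exp_mul_equil_le h0)
          refine le_trans ?_ (mul_le_mul_of_nonneg_left (hη.exp_neg_le_equil _) (Real.exp_pos _).le)
          rw [← Real.exp_add, ← Real.exp_add]
          refine Real.exp_le_exp.mpr ?_
          have h1 := integral_block ha hb η m j
          rw [← intervalIntegral.integral_add_adjacent_intervals
            (hη.intervalIntegrable _ t) (hη.intervalIntegrable t _)] at h1
          have h2 := (abs_le.mp (hη.abs_integral_le t (-(j * m)))).1
          have h3 : |-(j * m : ℝ) - t| ≤ 1 := abs_le.mpr ⟨by linarith [ht.2], by linarith [ht.1]⟩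
          have h4 := mul_le_mul_of_nonneg_left h3 hK
          linarith
      _ ≤ _ := intervalIntegral.integral_mono_interval (by linarith) hle le_rfl
          (Eventually.of_forall fun s => (hη.equil_pos s).le) (hη.intervalIntegrable_equil _ _)
  have hev : ∀ᶠ n : ℕ in atTop, 2 * |C| * m * n ≤ ∫ r in (-(n * m) : ℝ)..0, equil f r := by
    have hρm : ρ ^ m / 2 < ρ ^ m := half_lt_self (by positivity)
    filter_upwards [(h m).eventually_const_le hρm, eventually_gt_atTop 0] with n hn hn0
    have hn0' : (0 : ℝ) < n := by exact_mod_cast hn0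
    rw [le_div_iff₀ hn0'] at hn
    rw [← sum_integral_blocks hη.intervalIntegrable_equil]
    refine le_trans ?_ (Finset.sum_le_sum fun j _ => hblock j)
    rw [← Finset.mul_sum]
    refine le_trans ?_ (mul_le_mul_of_nonneg_left hn hc.le)
    nlinarith
  have hev' := (tendsto_nat_floor_atTop.comp (tendsto_id.atTop_div_const hm0)).comp
    tendsto_neg_atBot_atTop |>.eventually (hev.and (eventually_ge_atTop 1))
  filter_upwards [hev', eventually_le_atBot 0] with s hs hs0
  obtain ⟨h1, h2⟩ := hs
  simp only [Function.comp, id] at h1 h2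
  set n := ⌊-s / m⌋₊
  have hn1 : (1 : ℝ) ≤ n := by exact_mod_cast h2
  have h3 : (n : ℝ) * m ≤ -s := by
    rw [← le_div_iff₀ hm0]
    exact Nat.floor_le (div_nonneg (by linarith) hm0.le)
  have h4 : -s ≤ (n + 1) * m := by
    rw [← div_le_iff₀ hm0]
    exact (Nat.lt_floor_add_one _).le
  calc C * (-s) ≤ |C| * (-s) := mul_le_mul_of_nonneg_right (le_abs_self C) (by linarith)
    _ ≤ |C| * ((n + 1) * m) := by gcongr
    _ ≤ 2 * |C| * m * n := by
        have : 0 ≤ |C| * m := by positivity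
        nlinarith
    _ ≤ _ := h1
    _ ≤ ∫ r in s..0, equil f r := by
        refine intervalIntegral.integral_mono_interval (by linarith) (by
          have : 0 ≤ (n : ℝ) * m := by positivity
          linarith) le_rfl
          (Eventually.of_forall fun s => (hη.equil_pos s).le) (hη.intervalIntegrable_equil _ _)

theorem ae_isGoodPath {q : unitInterval} (ha : 0 < a) (hb : 0 < b)
    (hρ : 1 < (q : ℝ) * Real.exp (-a) + (1 - (q : ℝ)) * Real.exp b)
    (hlam : 0 < (q : ℝ) * a + (1 - (q : ℝ)) * (-b)) :
    ∀ᵐ η ∂(bernoulliProd a b q),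
      IsGoodPath (max a b) ((q : ℝ) * a + (1 - (q : ℝ)) * (-b)) (damping η) := by
  have h1 := ae_tendsto_blockSum (q := q) ha hb 1 continuous_id
  -- There are only countably many block lengths, so one null set serves them all.
  have h2 : ∀ᵐ η ∂(bernoulliProd a b q), ∀ m : ℕ, _ := ae_all_iff.mpr fun m =>
    ae_tendsto_blockSum (q := q) ha hb m (ψ := fun x => Real.exp (-x)) (by fun_prop)
  simp only [id, integral_blockSum_one] at h1
  simp only [integral_exp_neg_blockSum] at h2
  filter_upwards [h1, h2] with η h1 h2
  have hd : IsDissipativePath (max a b) ((q : ℝ) * a + (1 - (q : ℝ)) * (-b)) (damping η) :=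
    ⟨measurable_damping η, fun t => abs_coe_le ha hb (η ⌊t⌋), rightCts_damping η, hlam,
      tendsto_mean_damping ha hb η h1⟩
  exact ⟨hd.measurable, hd.abs_le_bound, hd.rightCts, hlam, hd.mean,
    growth_of_blocks ha hb η hd hρ h2⟩

end Path

end ToySystem

/-! ### Measurability of the attractor -/

namespace ToySystem

section Measurability

variable {Ω : Type*} [MeasurableSpace Ω]

theorem measurable_integral_Iic {φ : Ω → ℝ → ℝ} (hφ : Measurable (Function.uncurry φ))
    {c : Ω → ℝ} (hc : Measurable c) : Measurable fun ω => ∫ s in Iic (c ω), φ ω s := by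
  have h1 : (fun ω => ∫ s in Iic (c ω), φ ω s) =
      fun ω => ∫ s, (fun ω s => {p : Ω × ℝ | p.2 ≤ c p.1}.indicator (Function.uncurry φ) (ω, s)) ω s := by
    funext ω
    rw [← integral_indicator measurableSet_Iic]
    rfl
  rw [h1]
  refine (StronglyMeasurable.integral_prod_right (Measurable.stronglyMeasurable ?_)).measurable
  exact hφ.indicator (measurableSet_le measurable_snd (hc.comp measurable_fst))

theorem measurable_intervalIntegral {φ : Ω → ℝ → ℝ} (hφ : Measurable (Function.uncurry φ))
    {c d : Ω → ℝ} (hc : Measurable c) (hd : Measurable d) :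
    Measurable fun ω => ∫ s in (c ω)..(d ω), φ ω s := by
  have h : ∀ {c d : Ω → ℝ}, Measurable c → Measurable d →
      Measurable fun ω => ∫ s in Ioc (c ω) (d ω), φ ω s := by
    intro c d hc hd
    have h1 : (fun ω => ∫ s in Ioc (c ω) (d ω), φ ω s) =
        fun ω => ∫ s, (fun ω s => ({p : Ω × ℝ | c p.1 < p.2} ∩ {p : Ω × ℝ | p.2 ≤ d p.1}).indicator
          (Function.uncurry φ) (ω, s)) ω s := by
      funext ω
      rw [← integral_indicator measurableSet_Ioc]
      rfl
    rw [h1]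
    refine (StronglyMeasurable.integral_prod_right (Measurable.stronglyMeasurable ?_)).measurable
    exact hφ.indicator ((measurableSet_lt (hc.comp measurable_fst) measurable_snd).inter
      (measurableSet_le measurable_snd (hd.comp measurable_fst)))
  exact (h hc hd).sub (h hd hc)

variable {a b : ℝ}

theorem measurable_uncurry_damping :
    Measurable (Function.uncurry fun (η : BernoulliScheme a b) => damping η) := by
  have h1 : Measurable fun p : BernoulliScheme a b × ℤ => (p.1 p.2 : ℝ) :=
    measurable_from_prod_countable_left fun n => measurable_coe_apply n
  exact h1.comp (measurable_fst.prodMk (Int.measurable_floor.comp measurable_snd))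

theorem measurable_uncurry_equil :
    Measurable (Function.uncurry fun (η : BernoulliScheme a b) => equil (damping η)) := by
  refine measurable_integral_Iic (Ω := BernoulliScheme a b × ℝ)
    (φ := fun p s => Real.exp (-∫ r in s..p.2, damping p.1 r)) ?_ measurable_snd
  refine Real.measurable_exp.comp (Measurable.neg ?_)
  refine measurable_intervalIntegral (Ω := (BernoulliScheme a b × ℝ) × ℝ)
    (φ := fun p r => damping p.1.1 r) ?_ measurable_snd (measurable_snd.comp measurable_fst)
  exact measurable_uncurry_damping.comp
    ((measurable_fst.comp (measurable_fst.comp measurable_fst)).prodMk measurable_snd)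

theorem measurable_equil (t : ℝ) :
    Measurable fun η : BernoulliScheme a b => equil (damping η) t :=
  measurable_uncurry_equil.comp (measurable_id.prodMk measurable_const)

theorem measurable_radius (k : ℕ+) (t : ℝ) :
    Measurable fun η : BernoulliScheme a b => radius (damping η) k t := by
  have h : Measurable fun η : BernoulliScheme a b => barrier (damping η) k t := by
    refine measurable_integral_Iic (φ := fun (η : BernoulliScheme a b) s =>
      Real.exp (-2 * ∫ r in s..t, (equil (damping η) r - ((k : ℕ) : ℝ) ^ 4))) ?_ measurable_const
    refine Real.measurable_exp.comp (Measurable.const_mul ?_ _)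
    refine measurable_intervalIntegral (Ω := BernoulliScheme a b × ℝ)
      (φ := fun p r => equil (damping p.1) r - ((k : ℕ) : ℝ) ^ 4) ?_ measurable_snd measurable_const
    exact (measurable_uncurry_equil.comp
      ((measurable_fst.comp measurable_fst).prodMk measurable_snd)).sub measurable_const
  exact ((h.const_mul 2).sqrt).inv

instance : TopologicalSpace.SeparableSpace H := by
  rw [← TopologicalSpace.isSeparable_univ_iff]
  let e : ℕ+ → H := fun k => lp.single 2 k (1 : ℝ)
  have h1 : TopologicalSpace.IsSeparable (closure (Submodule.span ℝ (range e) : Set H)) :=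
    ((countable_range e).isSeparable.span (R := ℝ)).closure
  refine h1.mono fun x _ => ?_
  refine mem_closure_of_tendsto (lp.hasSum_single (p := 2) (by norm_num) x)
    (Eventually.of_forall fun s => Submodule.sum_mem _ fun k _ => ?_)
  have h2 : lp.single 2 k (x k) = x k • e k := by
    rw [← lp.single_smul, smul_eq_mul, mul_one]
  rw [h2]
  exact Submodule.smul_mem _ _ (Submodule.subset_span (mem_range_self k))

/-- Maps into `H` with measurable coordinates hit open sets measurably. -/
theorem measurableSet_preimage_of_coord {F : Ω → H} (hF : ∀ k, Measurable fun ω => F ω k)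
    {O : Set H} (hO : IsOpen O) : MeasurableSet (F ⁻¹' O) := by
  have := UniformSpace.secondCountable_of_separable H
  borelize H
  have h1 : Measurable F := by
    refine measurable_of_tendsto_metrizable' (u := (atTop : Filter (Finset ℕ+)))
      (f := fun s ω => ∑ k ∈ s, lp.single 2 k (F ω k)) (fun s => ?_) ?_
    · refine Finset.measurable_fun_sum s fun k _ => ?_
      have hc : Continuous fun x : ℝ => (lp.single 2 k x : H) :=
        (lp.isometry_single (E := fun _ : ℕ+ => ℝ) (p := 2) k).continuous
      exact hc.measurable.comp (hF k)
    · exact tendsto_pi_nhds.mpr fun ω => lp.hasSum_single (by norm_num) (F ω)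
  exact h1 hO.measurableSet

/-- The projections of a dense sequence are dense in the box (a Castaing representation), so hitting
an open set is a countable union of conditions on measurable points. -/
theorem box_inter_nonempty_iff {c : ℝ} {r : ℕ+ → ℝ} (hr : ∀ k, 2 ≤ k → 0 ≤ r k)
    {O : Set H} (hO : IsOpen O) : (box c r ∩ O).Nonempty ↔
      ∃ n, proj c r hr (TopologicalSpace.denseSeq H n) ∈ O := by
  constructor
  · rintro ⟨x, hx, hxO⟩
    have h1 : IsOpen (proj c r hr ⁻¹' O) := hO.preimage (lipschitzWith_proj hr).continuous
    exact (TopologicalSpace.denseRange_denseSeq H).exists_mem_open h1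
      ⟨x, by rw [mem_preimage, proj_of_mem hr hx]; exact hxO⟩
  · rintro ⟨n, hn⟩
    exact ⟨_, proj_mem hr _, hn⟩

theorem measurableSet_attr (t : ℝ) {O : Set H} (hO : IsOpen O) :
    MeasurableSet {η : BernoulliScheme a b | (attr (shift t (damping η)) ∩ O).Nonempty} := by
  simp_rw [attr_shift]
  have h : {η : BernoulliScheme a b | (box (equil (damping η) t)
      (fun k => radius (damping η) k t) ∩ O).Nonempty} =
      ⋃ n, (fun η : BernoulliScheme a b => proj (equil (damping η) t)
        (fun k => radius (damping η) k t) (fun k _ => radius_nonneg _ k t)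
        (TopologicalSpace.denseSeq H n)) ⁻¹' O := by
    ext η
    simp only [mem_ofPred_eq, mem_iUnion, mem_preimage]
    exact box_inter_nonempty_iff _ hO
  rw [h]
  refine MeasurableSet.iUnion fun n => measurableSet_preimage_of_coord (fun k => ?_) hO
  change Measurable fun η : BernoulliScheme a b => clamp (equil (damping η) t)
    (fun k => radius (damping η) k t) (TopologicalSpace.denseSeq H n) k
  unfold clamp
  by_cases hk : k = 1
  · simp only [if_pos hk]
    exact measurable_equil t
  · simp only [if_neg hk]
    exact (measurable_radius k t).neg.max ((measurable_radius k t).min measurable_const)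

end Measurability

/-! ### Minimality of the box and the main theorem -/

variable {K lam : ℝ} {f : ℝ → ℝ}

/-- The attractor is contained in every closed set which attracts it. -/
theorem IsGoodPath.attr_subset (hf : IsGoodPath K lam f) {A : Set H} (hA : IsClosed A)
    (h : Tendsto (fun τ => semiDist (evolve f 0 τ (attr (shift τ f))) A) atBot (𝓝 0)) :
    attr f ⊆ A := by
  -- By invariance the evolved set equals `attr f` for every τ ≤ 0, so the family tending to 0 is
  -- constant.
  have h1 : Tendsto (fun _ : ℝ => semiDist (attr f) A) atBot (𝓝 0) := by
    refine h.congr' ?_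
    filter_upwards [eventually_le_atBot 0] with τ hτ
    rw [attr_shift, hf.evolve_eq hτ]
    rfl
  have h2 : semiDist (attr f) A = 0 := tendsto_nhds_unique tendsto_const_nhds h1
  intro x hx
  rw [← hA.closure_eq, Metric.mem_closure_iff_infEDist_zero]
  exact le_antisymm ((le_iSup₂ (f := fun u (_ : u ∈ attr f) => Metric.infEDist u A) x hx).trans_eq h2)
    zero_le

theorem IsGoodPath.dim_eq_top_of_attr_subset (hf : IsGoodPath K lam f) {A : Set H}
    (h : attr f ⊆ A) : dimH A = ⊤ ∧ fractalDim A = ⊤ :=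
  ⟨dimH_eq_top_of_box_subset (fun k _ => hf.radius_pos k 0) h,
    fractalDim_eq_top_of_box_subset (fun k _ => hf.radius_pos k 0) h⟩

theorem isTemperedRandomSet_attr {a b : ℝ} {q : unitInterval}
    (h : ∀ᵐ η ∂(bernoulliProd a b q), IsGoodPath K lam (damping η)) :
    IsTemperedRandomSet a b q attr :=
  ⟨fun t _ hO => (measurableSet_attr t hO).nullMeasurableSet,
    h.mono fun _ hη => hη.isTemperedFamily_attr⟩

theorem isRandomAttractor_attr {a b : ℝ} {q : unitInterval}
    (h : ∀ᵐ η ∂(bernoulliProd a b q), IsGoodPath K lam (damping η)) :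
    IsRandomAttractor a b q attr where
  isTemperedRandomSet := isTemperedRandomSet_attr h
  isCompact := h.mono fun _ hη => hη.isCompact_attr_at 0
  invariant := h.mono fun η hη t ht => by
    rw [attr_shift]
    exact hη.evolve_eq ht
  attracts := fun B hB => by
    filter_upwards [h, hB.tempered] with η hη hBη
    exact hη.tendsto_semiDist hBη

end ToySystem

theorem mainTheorem7 (a b : ℝ) (ha : 0 < a) (hb : 0 < b)
    (q : unitInterval) (hq0 : 0 < q) (hq1 : q < 1)
    (h_infinite_mean :
      0 < Real.log ((q : ℝ) * Real.exp (-a) + (1 - (q : ℝ)) * Real.exp b))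
    (h_dissipative : -a * (q : ℝ) + (1 - (q : ℝ)) * b < 0) :
    (∃ A : (ℝ → ℝ) → Set ToySystem.H, ToySystem.IsRandomAttractor a b q A) ∧
    ∀ A : (ℝ → ℝ) → Set ToySystem.H, ToySystem.IsRandomAttractor a b q A →
      ∀ᵐ η ∂(ToySystem.bernoulliProd a b q),
        dimH (A (ToySystem.damping η)) = ⊤ ∧
        ToySystem.fractalDim (A (ToySystem.damping η)) = ⊤ := by
  have hρ : 1 < (q : ℝ) * Real.exp (-a) + (1 - (q : ℝ)) * Real.exp b := by
    have h0 : 0 ≤ (q : ℝ) * Real.exp (-a) + (1 - (q : ℝ)) * Real.exp b :=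
      add_nonneg (mul_nonneg q.2.1 (Real.exp_pos _).le)
        (mul_nonneg (sub_nonneg.mpr q.2.2) (Real.exp_pos _).le)
    exact (Real.log_pos_iff h0).mp h_infinite_mean
  have hgood := ToySystem.ae_isGoodPath ha hb hρ (by linarith)
  refine ⟨⟨ToySystem.attr, ToySystem.isRandomAttractor_attr hgood⟩, fun A hA => ?_⟩
  filter_upwards [hgood, hA.isCompact, hA.attracts _ (ToySystem.isTemperedRandomSet_attr hgood)]
    with η hη hc hattr
  exact hη.dim_eq_top_of_attr_subset (hη.attr_subset hc.isClosed hattr)
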